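/- **Setting.** Let $\mathcal Y\subset\mathbb R^d$ be a bounded open set with Lipschitz boundary, let $\mathcal S=\mathbb R^{d+Q}$, and let $L_1,\dots,L_Q$ be linear differential operators on $\mathcal Y$ of order at most $p$ with continuous coefficients. For a function $v$ on $\mathcal Y$ (of class $C^p$) and $y\in\mathcal Y$ put $$\Phi(v,y)=(y,\,L_1v(y),\dots,L_Qv(y))\in\mathcal S .$$ For $k\in\mathbb N_0$ and $\Omega$ open, $H^k(\Omega)$ is the $L^2$-based Sobolev space with $\|u\|_{H^k(\Omega)}^2=\sum_{|\alpha|\le k}\|D^\alpha u\|_{L^2(\Omega)}^2$; in particular $H^0=L^2$. Assume: * $\mathsf U$ is a continuous, positive definite and symmetric kernel on $\mathcal Y$ whose reproducing kernel Hilbert space (RKHS) $\mathcal U$ is compactly embedded in $H^\gamma(\mathcal Y)$ for some integer $\gamma>d/2+p$, and all elements $v$ of $\mathcal U$ satisfy the boundary condition $\mathscr B(v)=g$ on $\partial\mathcal Y$, where $\mathscr B$ is a boundary operator and $g$ is given; * $\mathsf P$ is a positive definite and symmetric kernel on $\mathcal S$ whose RKHS $\mathcal P$ consists of continuous functions and is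 compactly embedded in $H^\eta(\mathcal S)$ for some integer $\eta>(Q+d)/2$; * $P\in\mathcal P$, the function $\overline P:\mathcal S\to\mathbb R$ is continuous, and $(u^m,f^m)_{m\ge1}$ are pairs of functions on $\mathcal Y$ with $$(\overline P+P)(\Phi(u^m,y))=f^m(y)\ \ (y\in\mathcal Y),\qquad \mathscr B(u^m)=g\ \text{ on }\partial\mathcal Y .$$ For $m,N$ let $Y^m_N\subset\mathcal Y$ be a finite set of observation points and let $Y_{M,N}=\bigcup_{m=1}^MY^m_N$. Let $(\widehat u^1_{M,N},\dots,\widehat u^M_{M,N},\widehat P_{M,N})\in\mathcal U^M\times\mathcal P$ be any minimizer of $$\|G\|_{\mathcal P}^2+\sum_{m=1}^M\|v^m\|_{\mathcal U}^2$$ over all $(v^1,\dots,v^M,G)\in\mathcal U^M\times\mathcal P$ such that, for $m=1,\dots,M$, $$v^m(y)=u^m(y)\ \ (y\in Y^m_N),\qquad G(\Phi(v^m,y))=f^m(y)-\overline P(\Phi(v^m,y))\ \ (y\in Y_{M,N}).$$ Let $B\subset\mathcal S$ be a bounded open set with Lipschitz boundary, and let $S_{M,N}=\bigcup_{m=1}^M\Phi(u^m,Y_{M,N})$.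 Suppose that the fill distances satisfy $$\rho_{m,N}=\sup_{y\in\mathcal Y}\inf_{y'\in Y^m_N}\|y-y'\|_2\to0\ \ (N\to\infty)\ \text{ for every }m,\qquad \varrho_{M,N}(B)=\sup_{s\in B}\inf_{s'\in S_{M,N}\cap B}\|s-s'\|_2\to0\ \ (M,N\to\infty),$$ where an infimum over the empty set is $+\infty$. Finally, for a Mercer expansion $\mathsf U(y,y')=\sum_{i=1}^\infty\lambda_ie_i(y)e_i(y')$ with $\lambda_1\ge\lambda_2\ge\dots\ge0$ and continuous functions $e_i$ that are orthonormal in $L^2(\mathcal Y)$, let $\mathcal U^2$ be the space of all functions $\sum_{i:\lambda_i\ne0}c_ie_i$ with $\sum_{i:\lambda_i\neq0}\lambda_i^{-2}c_i^2<\infty$. **Proposition.** (a) Fix $M$. If $u^m\in\mathcal U$ for $m=1,\dots,M$, then for every $m\in\{1,\dots,M\}$, as $N\to\infty$, $\widehat u^m_{M,N}\to u^m$ pointwise in $\mathcal Y$ and in $H^{\gamma'}(\mathcal Y)$ for every integer $0\le\gamma'<\gamma$. (b) If $u^m\in\mathcal U^2$ for all $m$, then $\lim_{M\to\infty}\lim_{N\to\infty}\widehat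 P_{M,N}=P$ pointwise in $B$ and in $H^{\eta'}(B)$ for every integer $0\le\eta'<\eta$. That is, for every $M$ the limit $P_M:=\lim_{N\to\infty}\widehat P_{M,N}$ exists, pointwise in $B$ and in $H^{\eta'}(B)$, and $P_M\to P$ as $M\to\infty$ in the same senses. -/

import Mathlib

open MeasureTheory Filter Topology
open scoped ENNReal ContDiff

noncomputable section

namespace KEqL

/-- `ℝⁿ` with the Euclidean norm. -/
abbrev E (n : ℕ) : Type := EuclideanSpace ℝ (Fin n)

/-! ### Domains and fill distances -/

/-- `Ω` has Lipschitz boundary: near each boundary point it is, for some unit vector `e`, the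
strict epigraph in direction `e` of a Lipschitz function of the component orthogonal to `e`. -/
def HasLipschitzBoundary {n : ℕ} (Ω : Set (E n)) : Prop :=
  ∀ x ∈ frontier Ω, ∃ r > 0, ∃ e : E n, ‖e‖ = 1 ∧ ∃ (g : E n → ℝ) (K : NNReal),
    LipschitzWith K g ∧
      ∀ y ∈ Metric.ball x r, y ∈ Ω ↔ g (y - inner ℝ e y • e) < inner ℝ e y

/-- The fill distance `sup_{y ∈ A} inf_{x ∈ X} ‖y - x‖` of `X` in `A`
(it is `∞` if `X` is empty and `A` is not). -/
def fillDistance {n : ℕ} (A X : Set (E n)) : ℝ≥0∞ := ⨆ y ∈ A, Metric.infEDist y X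

/-! ### Multi-indices and classical derivatives -/

/-- The multi-indices `α ∈ ℕⁿ` with `|α| ≤ k`. -/
def multiIdx (n k : ℕ) : Finset (Fin n → ℕ) :=
  (Fintype.piFinset fun _ => Finset.range (k + 1)).filter fun α => ∑ i, α i ≤ k

lemma mem_multiIdx {n k : ℕ} {α : Fin n → ℕ} : α ∈ multiIdx n k ↔ ∑ i, α i ≤ k := by
  simp only [multiIdx, Finset.mem_filter, Fintype.mem_piFinset, Finset.mem_range,
    and_iff_right_iff_imp]
  intro h i
  have := Finset.single_le_sum (f := α) (fun j _ => Nat.zero_le _) (Finset.mem_univ i)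
  omega

/-- The multi-index `0`. -/
def zeroIdx (n k : ℕ) : multiIdx n k := ⟨0, by simp [mem_multiIdx]⟩

/-- The classical partial derivative `∂f/∂xᵢ`. -/
def partialDeriv {n : ℕ} (i : Fin n) (f : E n → ℝ) : E n → ℝ :=
  fun x => fderiv ℝ f x (EuclideanSpace.single i 1)

/-- The classical derivative `D^α f = ∂₁^{α₁} ⋯ ∂ₙ^{αₙ} f`. -/
def multiDeriv {n : ℕ} (α : Fin n → ℕ) (f : E n → ℝ) : E n → ℝ :=
  (List.finRange n).foldr (fun i g => (partialDeriv i)^[α i] g) f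

/-! ### Sobolev spaces of integer order -/

/-- Smooth functions with compact support inside `Ω`. -/
structure IsTest {n : ℕ} (Ω : Set (E n)) (φ : E n → ℝ) : Prop where
  contDiff : ContDiff ℝ ∞ φ
  compact : HasCompactSupport φ
  subset : tsupport φ ⊆ Ω

lemma contDiff_compact_iterate {n : ℕ} (i : Fin n) (k : ℕ) {φ : E n → ℝ}
    (h : ContDiff ℝ ∞ φ ∧ HasCompactSupport φ) :
    ContDiff ℝ ∞ ((partialDeriv i)^[k] φ) ∧ HasCompactSupport ((partialDeriv i)^[k] φ) := by
  induction k generalizing φ with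
  | zero => exact h
  | succ k ih =>
    rw [Function.iterate_succ_apply]
    refine ih ⟨?_, h.2.fderiv_apply ℝ _⟩
    exact (h.1.fderiv_right (m := ∞) (by simp)).clm_apply contDiff_const

lemma contDiff_compact_multiDeriv {n : ℕ} (α : Fin n → ℕ) {φ : E n → ℝ}
    (h : ContDiff ℝ ∞ φ ∧ HasCompactSupport φ) :
    ContDiff ℝ ∞ (multiDeriv α φ) ∧ HasCompactSupport (multiDeriv α φ) := by
  unfold multiDeriv
  induction List.finRange n with
  | nil => exact h
  | cons i l ih => exact contDiff_compact_iterate i (α i) ih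

/-- `g` is the weak derivative `D^α f` on `Ω` (used for `f, g ∈ L²(Ω)`). -/
def IsWeakDeriv {n : ℕ} (Ω : Set (E n)) (α : Fin n → ℕ) (f g : E n → ℝ) : Prop :=
  ∀ φ : E n → ℝ, IsTest Ω φ →
    ∫ x in Ω, f x * multiDeriv α φ x = (-1) ^ (∑ i, α i) * ∫ x in Ω, g x * φ x

lemma integrable_mul_of_compact {n : ℕ} {μ : Measure (E n)} [IsFiniteMeasureOnCompacts μ]
    (f : Lp ℝ 2 μ) {ψ : E n → ℝ} (h : ContDiff ℝ ∞ ψ ∧ HasCompactSupport ψ) :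
    Integrable (fun x => f x * ψ x) μ :=
  (Lp.memLp f).integrable_mul (q := 2) (h.1.continuous.memLp_of_hasCompactSupport h.2)

lemma isWeakDeriv_zero {n : ℕ} (Ω : Set (E n)) (α : Fin n → ℕ) :
    IsWeakDeriv Ω α (0 : Lp ℝ 2 (volume.restrict Ω)) (0 : Lp ℝ 2 (volume.restrict Ω)) := by
  intro φ _
  have h0 : ∀ ψ : E n → ℝ,
      ∫ x in Ω, (0 : Lp ℝ 2 (volume.restrict Ω)) x * ψ x = 0 := fun ψ => by
    refine integral_eq_zero_of_ae ?_
    filter_upwards [Lp.coeFn_zero ℝ 2 (volume.restrict Ω)] with x hx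
    simp only [hx, Pi.zero_apply, zero_mul]
  rw [h0, h0, mul_zero]

lemma isWeakDeriv_add {n : ℕ} {Ω : Set (E n)} {α : Fin n → ℕ}
    {f g f' g' : Lp ℝ 2 (volume.restrict Ω)}
    (h : IsWeakDeriv Ω α f g) (h' : IsWeakDeriv Ω α f' g') :
    IsWeakDeriv Ω α (f + f' : Lp ℝ 2 (volume.restrict Ω))
      (g + g' : Lp ℝ 2 (volume.restrict Ω)) := by
  intro φ hφ
  have key : ∀ (a b : Lp ℝ 2 (volume.restrict Ω)) (ψ : E n → ℝ),
      ContDiff ℝ ∞ ψ ∧ HasCompactSupport ψ →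
      ∫ x in Ω, (a + b : Lp ℝ 2 (volume.restrict Ω)) x * ψ x
        = (∫ x in Ω, a x * ψ x) + ∫ x in Ω, b x * ψ x := fun a b ψ hψ => by
    rw [← integral_add (integrable_mul_of_compact a hψ) (integrable_mul_of_compact b hψ)]
    refine integral_congr_ae ?_
    filter_upwards [Lp.coeFn_add a b] with x hx
    simp only [hx, Pi.add_apply, add_mul]
  have h1 : ContDiff ℝ ∞ φ ∧ HasCompactSupport φ := ⟨hφ.contDiff, hφ.compact⟩
  rw [key f f' _ (contDiff_compact_multiDeriv α h1), key g g' _ h1, h φ hφ, h' φ hφ, mul_add]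

lemma isWeakDeriv_smul {n : ℕ} {Ω : Set (E n)} {α : Fin n → ℕ} (c : ℝ)
    {f g : Lp ℝ 2 (volume.restrict Ω)} (h : IsWeakDeriv Ω α f g) :
    IsWeakDeriv Ω α (c • f : Lp ℝ 2 (volume.restrict Ω))
      (c • g : Lp ℝ 2 (volume.restrict Ω)) := by
  intro φ hφ
  have key : ∀ (a : Lp ℝ 2 (volume.restrict Ω)) (ψ : E n → ℝ),
      ∫ x in Ω, (c • a : Lp ℝ 2 (volume.restrict Ω)) x * ψ x
        = c * ∫ x in Ω, a x * ψ x := fun a ψ => by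
    rw [← integral_const_mul]
    refine integral_congr_ae ?_
    filter_upwards [Lp.coeFn_smul c a] with x hx
    simp [hx, mul_assoc]
  rw [key, key, h φ hφ]
  ring

/-- The Sobolev space `H^k(Ω)`: families `(w_α)_{|α| ≤ k}` in `L²(Ω)` such that `w_α` is the weak
derivative `D^α w₀`. An element is determined by `w₀`, and the norm inherited from the
`ℓ²`-product is `‖w‖² = ∑_{|α| ≤ k} ‖D^α w₀‖²_{L²(Ω)}`. -/
def SobolevSpace {n : ℕ} (k : ℕ) (Ω : Set (E n)) :
    Submodule ℝ (PiLp 2 fun _ : multiIdx n k => Lp ℝ 2 (volume.restrict Ω)) where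
  carrier := {w | ∀ α : multiIdx n k, IsWeakDeriv Ω α.1 (w (zeroIdx n k)) (w α)}
  add_mem' h h' α := isWeakDeriv_add (h α) (h' α)
  zero_mem' α := isWeakDeriv_zero Ω α.1
  smul_mem' c _ h α := isWeakDeriv_smul c (h α)

/-- `w ∈ H^k(Ω)` is the class of the function `f`. -/
def Represents {n k : ℕ} {Ω : Set (E n)} (w : SobolevSpace k Ω) (f : E n → ℝ) : Prop :=
  w.1 (zeroIdx n k) =ᵐ[volume.restrict Ω] f

/-- The norm `‖f‖_{H^k(Ω)}`, with value `∞` if (the class of) `f` is not in `H^k(Ω)`. -/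
def sobolevENorm {n : ℕ} (k : ℕ) (Ω : Set (E n)) (f : E n → ℝ) : ℝ≥0∞ :=
  ⨅ (w : SobolevSpace k Ω) (_ : Represents w f), ‖w‖ₑ

/-- The extension by zero of a function on `Ω`. -/
def ext0 {n : ℕ} {Ω : Set (E n)} (v : Ω → ℝ) : E n → ℝ := Function.extend Subtype.val v 0

/-- A normed space `V`, whose elements `v` are regarded as the functions `F v` on `Ω`, is compactly
embedded in `H^k(Ω)`: `v ↦ F v` is a bounded and compact linear map `V → H^k(Ω)`. -/
def CompactlyEmbedded {n : ℕ} {V : Type*} [NormedAddCommGroup V] [NormedSpace ℝ V]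
    (F : V → E n → ℝ) (k : ℕ) (Ω : Set (E n)) : Prop :=
  ∃ ι : V →L[ℝ] SobolevSpace k Ω, IsCompactOperator ι ∧ ∀ v, Represents (ι v) (F v)

/-! ### Reproducing kernels -/

/-- The (real-valued, positive semidefinite) kernel of a reproducing kernel Hilbert space. -/
def rkhsKernel (H : Type*) {X : Type*} [NormedAddCommGroup H] [InnerProductSpace ℝ H]
    [CompleteSpace H] [RKHS ℝ H X ℝ] (x y : X) : ℝ := RKHS.kernel H x y 1

/-- A Mercer expansion `K(x, x') = ∑ᵢ λᵢ eᵢ(x) eᵢ(x')`, with `λ` nonnegative and nonincreasing, and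
`eᵢ` continuous and orthonormal in `L²(Ω)`; indices with `λᵢ = 0` play no role. -/
structure IsMercerExpansion {n : ℕ} {Ω : Set (E n)} (K : Ω → Ω → ℝ) (lam : ℕ → ℝ)
    (e : ℕ → Ω → ℝ) : Prop where
  nonneg : ∀ i, 0 ≤ lam i
  antitone : Antitone lam
  continuous : ∀ i, Continuous (e i)
  memLp : ∀ i, lam i ≠ 0 → MemLp (ext0 (e i)) 2 (volume.restrict Ω)
  orthonormal : ∀ i j, lam i ≠ 0 → lam j ≠ 0 →
    ∫ x in Ω, ext0 (e i) x * ext0 (e j) x = if i = j then 1 else 0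
  hasSum : ∀ x x', HasSum (fun i => lam i * e i x * e i x') (K x x')

/-- The space `𝓗^θ` of the ladder generated by the kernel `K`: all functions `f = ∑ᵢ cᵢ eᵢ`, the
sum over the `i` with `λᵢ ≠ 0`, with `∑ᵢ λᵢ^{-θ} cᵢ² < ∞`. -/
def powerSpace {n : ℕ} {Ω : Set (E n)} (K : Ω → Ω → ℝ) (θ : ℝ) : Set (Ω → ℝ) :=
  {f | ∃ lam e, IsMercerExpansion K lam e ∧ ∃ c : ℕ → ℝ, (∀ i, lam i = 0 → c i = 0) ∧
    Summable (fun i => lam i ^ (-θ) * c i ^ 2) ∧ ∀ x, HasSum (fun i => c i * e i x) (f x)}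

/-! ### The learning problem -/

/-- A linear differential operator `∑_{|α| ≤ p} a_α D^α` on `Ω` of order at most `p`, with
continuous coefficients. -/
structure DiffOp {n : ℕ} (Ω : Set (E n)) (p : ℕ) where
  coeff : multiIdx n p → Ω → ℝ
  continuous_coeff : ∀ α, Continuous (coeff α)

/-- `(L v)(y)`. -/
def DiffOp.eval {n p : ℕ} {Ω : Set (E n)} (L : DiffOp Ω p) (v : Ω → ℝ) (y : Ω) : ℝ :=
  ∑ α, L.coeff α y * multiDeriv α.1 (ext0 v) y

variable {d p Q : ℕ} {𝓨 : Set (E d)}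

/-- `Φ(v, y) = (y, L₁ v(y), …, L_Q v(y)) ∈ 𝓢 = ℝ^{d + Q}`. -/
def Phi (L : Fin Q → DiffOp 𝓨 p) (v : 𝓨 → ℝ) (y : 𝓨) : E (d + Q) :=
  WithLp.toLp 2 (Fin.append (fun i => y.1 i) fun q => (L q).eval v y)

/-- The collocation points `Y_{M,N} = ⋃_{m < M} Y^m_N`. -/
def colloc (Y : ℕ → ℕ → Finset 𝓨) (M N : ℕ) : Set 𝓨 := ⋃ m < M, (Y m N : Set 𝓨)

/-- `S = ⋃_{m < M} Φ(u^m, Y_{M,N})`. -/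
def dataPoints (L : Fin Q → DiffOp 𝓨 p) (u : ℕ → 𝓨 → ℝ) (Y : ℕ → ℕ → Finset 𝓨) (M N : ℕ) :
    Set (E (d + Q)) :=
  ⋃ m < M, Phi L (u m) '' colloc Y M N

variable (HU HP : Type*) [NormedAddCommGroup HU] [InnerProductSpace ℝ HU] [RKHS ℝ HU 𝓨 ℝ]
  [NormedAddCommGroup HP] [InnerProductSpace ℝ HP] [RKHS ℝ HP (E (d + Q)) ℝ]

/-- The pairs `((v^m)_{m < M}, G)` that satisfy the constraints `v^m(Y^m_N) = u^m(Y^m_N)` and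
`G(Φ(v^m, y)) = f^m(y) - P̄(Φ(v^m, y))` for all `m < M` and `y ∈ Y_{M,N}`. -/
def feasible (L : Fin Q → DiffOp 𝓨 p) (Pbar : E (d + Q) → ℝ) (u f : ℕ → 𝓨 → ℝ)
    (Y : ℕ → ℕ → Finset 𝓨) (M N : ℕ) : Set ((Fin M → HU) × HP) :=
  {z | (∀ m : Fin M, ∀ y ∈ Y m N, z.1 m y = u m y) ∧
    ∀ m : Fin M, ∀ y ∈ colloc Y M N,
      z.2 (Phi L (z.1 m) y) = f m y - Pbar (Phi L (z.1 m) y)}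

/-- `z` is a minimizer of `‖G‖² + ∑_{m < M} ‖v^m‖²` over the feasible pairs. -/
def IsMinimizer (L : Fin Q → DiffOp 𝓨 p) (Pbar : E (d + Q) → ℝ) (u f : ℕ → 𝓨 → ℝ)
    (Y : ℕ → ℕ → Finset 𝓨) (M N : ℕ) (z : (Fin M → HU) × HP) : Prop :=
  z ∈ feasible HU HP L Pbar u f Y M N ∧
    IsMinOn (fun z : (Fin M → HU) × HP => ‖z.2‖ ^ 2 + ∑ m, ‖z.1 m‖ ^ 2)
      (feasible HU HP L Pbar u f Y M N) z

end KEqL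

end

open KEqL

/-!
A family of functions indexed by a Hilbert space `H`, with bounded point evaluations and values in
`H^k`, `k > n/2 + p`, is of class `C^p`, and its derivatives up to order `p` are inner products with
representers that depend continuously on the point. Locally this is Fourier analysis: the Fourier
transform of a compactly supported function in `H^k` has an integrable moment of order `p` by the
Cauchy–Schwarz inequality. Consequently `Φ(v, y)` is continuous in `(v, y)` when `v` carries the
weak topology of a bounded set.

The objective is the squared norm of the Hilbert sum `𝓤^M ⊕ 𝓟`. The pair `(u, P_M)`, where `P_M` is
the orthogonal projection of `P` onto the closed span of the kernel sections at the points
`Φ(u^m, y)`, `m < M`, is feasible for every `N` and so bounds the norms of the minimizers. The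
constraints survive weak limits, because the observation points become dense; hence every weak limit
has the state component `u` and an equation component that agrees with `P` at all `Φ(u^m, y)`. The
inner product of such a limit with `(u, P_M)` is `‖(u, P_M)‖²`, so the convergence is strong, and
strong convergence in an embedded Hilbert space gives both modes of convergence in the theorem.
As `M → ∞` the projections `P_M` converge to the projection onto the closure of the union of the
spans, which agrees with `P` on a set that is dense in `B`.
-/

namespace KEqL

open scoped FourierTransform NNReal RealInnerProductSpace

section Plancherel

variable {V : Type*} [NormedAddCommGroup V] [InnerProductSpace ℝ V] [FiniteDimensional ℝ V]
  [MeasurableSpace V] [BorelSpace V]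

lemma continuous_fourier {h : V → ℂ} (hint : Integrable h) : Continuous (𝓕 h) :=
  VectorFourier.fourierIntegral_continuous Real.continuous_fourierChar
    (by exact continuous_inner) hint

lemma integral_fourier_smul_eq {g h : V → ℂ} (hg : Integrable g) (hh : Integrable h) :
    ∫ ξ, 𝓕 g ξ • h ξ = ∫ x, g x • 𝓕 h x := by
  have hswap := VectorFourier.integral_fourierIntegral_smul_eq_flip (μ := (volume : Measure V))
    (ν := (volume : Measure V)) (L := innerₗ V) Real.continuous_fourierChar continuous_inner hg hh
  rwa [flip_innerₗ] at hswap

lemma fourier_toLp_ae_eq {h : V → ℂ} (hint : Integrable h) (hL2 : MemLp h 2) :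
    (𝓕 (hL2.toLp h) : Lp ℂ 2 (volume : Measure V)) =ᵐ[volume] 𝓕 h := by
  refine ae_eq_of_integral_contDiff_smul_eq ((Lp.memLp _).locallyIntegrable (by norm_num))
    (continuous_fourier hint).locallyIntegrable fun g hg hgc => ?_
  have hGc : HasCompactSupport (Complex.ofRealCLM ∘ g) := hgc.comp_left rfl
  have hGs : ContDiff ℝ ∞ (Complex.ofRealCLM ∘ g) := by fun_prop
  set G : SchwartzMap V ℂ := hGc.toSchwartzMap hGs with hG
  have hGg : ∀ x, G x = (g x : ℂ) := fun x => by simp [hG]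
  have hdual := congrArg (fun T => T G) (Lp.fourier_toTemperedDistribution_eq (hL2.toLp h))
  simp only [TemperedDistribution.fourier_apply, Lp.toTemperedDistribution_apply] at hdual
  calc ∫ x, g x • (𝓕 (hL2.toLp h) : Lp ℂ 2 (volume : Measure V)) x
      = ∫ x, G x • (𝓕 (hL2.toLp h) : Lp ℂ 2 (volume : Measure V)) x := by
        simp only [hGg, Complex.real_smul, smul_eq_mul]
    _ = ∫ x, (𝓕 G) x • (hL2.toLp h) x := hdual.symm
    _ = ∫ ξ, 𝓕 (G : V → ℂ) ξ • h ξ := by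
        refine integral_congr_ae ?_
        filter_upwards [hL2.coeFn_toLp] with x hx
        rw [hx, SchwartzMap.fourier_coe]
    _ = ∫ x, G x • 𝓕 h x := integral_fourier_smul_eq G.integrable hint
    _ = ∫ x, g x • 𝓕 h x := by simp only [hGg, Complex.real_smul, smul_eq_mul]

lemma memLp_fourier {h : V → ℂ} (hint : Integrable h) (hL2 : MemLp h 2) : MemLp (𝓕 h) 2 :=
  (memLp_congr_ae (fourier_toLp_ae_eq hint hL2)).1 (Lp.memLp _)

end Plancherel

section Localization

variable {n : ℕ} {Ω : Set (E n)} {χ w w' : E n → ℝ} {i : Fin n}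

/-- The product of a cutoff `χ` with a function `w`, regarded as a complex-valued function on `ℝⁿ`
so that its Fourier transform can be taken. -/
def cut (χ w : E n → ℝ) (x : E n) : ℂ := ((χ x * w x : ℝ) : ℂ)

lemma IsTest.contDiff_compact (hχ : IsTest Ω χ) : ContDiff ℝ ∞ χ ∧ HasCompactSupport χ :=
  ⟨hχ.contDiff, hχ.compact⟩

lemma IsTest.eq_zero (hχ : IsTest Ω χ) {x : E n} (hx : x ∉ Ω) : χ x = 0 :=
  image_eq_zero_of_notMem_tsupport fun h => hx (hχ.subset h)

lemma IsTest.mono {Ω' : Set (E n)} (hχ : IsTest Ω χ) (h : Ω ⊆ Ω') : IsTest Ω' χ :=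
  ⟨hχ.contDiff, hχ.compact, hχ.subset.trans h⟩

lemma IsTest.partialDeriv (hχ : IsTest Ω χ) (i : Fin n) : IsTest Ω (partialDeriv i χ) where
  contDiff := (contDiff_compact_iterate i 1 hχ.contDiff_compact).1
  compact := (contDiff_compact_iterate i 1 hχ.contDiff_compact).2
  subset := (tsupport_fderiv_apply_subset ℝ _).trans hχ.subset

lemma IsTest.mul_contDiff (hχ : IsTest Ω χ) {c : E n → ℝ} (hc : ContDiff ℝ ∞ c) :
    IsTest Ω fun x => χ x * c x :=
  ⟨hχ.contDiff.mul hc, hχ.compact.mul_right,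
    (tsupport_mul_subset_left (f := χ) (g := c)).trans hχ.subset⟩

lemma cut_eq_zero (hχ : IsTest Ω χ) {x : E n} (hx : x ∉ Ω) : cut χ w x = 0 := by
  simp [cut, hχ.eq_zero hx]

lemma integrable_cut_mul (hχ : IsTest Ω χ) (hw : MemLp w 2 (volume.restrict Ω)) {c : E n → ℂ}
    (hc : Continuous c) : Integrable fun x => cut χ w x * c x := by
  have hχc : MemLp (fun x => (χ x : ℂ) * c x) 2 (volume.restrict Ω) :=
    ((Complex.continuous_ofReal.comp hχ.contDiff.continuous).mul hc).memLp_of_hasCompactSupport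
      (hχ.compact.comp_left (g := fun r : ℝ => (r : ℂ)) Complex.ofReal_zero).mul_right
  refine (integrableOn_iff_integrable_of_support_subset (s := Ω) fun x hx => ?_).1 ?_
  · by_contra h
    exact hx (by simp only [cut_eq_zero hχ h, zero_mul])
  · refine ((hw.ofReal (K := ℂ)).integrable_mul hχc).congr (.of_forall fun x => ?_)
    simp only [Pi.mul_apply, cut, Complex.ofReal_mul, RCLike.ofReal_eq_complex_ofReal]
    ring

lemma integrable_cut (hχ : IsTest Ω χ) (hw : MemLp w 2 (volume.restrict Ω)) :
    Integrable (cut χ w) := by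
  simpa only [mul_one] using integrable_cut_mul hχ hw (continuous_const (y := (1 : ℂ)))

lemma memLp_cut (hΩ : IsOpen Ω) (hχ : IsTest Ω χ) (hw : MemLp w 2 (volume.restrict Ω)) :
    MemLp (cut χ w) 2 := by
  have hind : cut χ w = Ω.indicator (cut χ w) :=
    (Set.indicator_eq_self.2 (Function.support_subset_iff'.2 fun x hx => cut_eq_zero hχ hx)).symm
  obtain ⟨C, hC⟩ := hχ.compact.exists_bound_of_continuous hχ.contDiff.continuous
  rw [hind, memLp_indicator_iff_restrict hΩ.measurableSet]
  refine hw.of_le_mul (c := C) (integrable_cut hχ hw).1.restrict (.of_forall fun x => ?_)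
  rw [cut, Complex.norm_real, norm_mul]
  gcongr
  exact hC x

end Localization

section WeakDerivative

variable {n : ℕ} {Ω : Set (E n)} {χ w w' : E n → ℝ} {i : Fin n}

/-- The function `w'` is the first order weak derivative `∂w/∂xᵢ` on `Ω`. -/
def IsWeakPartial (Ω : Set (E n)) (i : Fin n) (w w' : E n → ℝ) : Prop :=
  ∀ φ : E n → ℝ, IsTest Ω φ → ∫ x in Ω, w x * partialDeriv i φ x = - ∫ x in Ω, w' x * φ x

lemma IsTest.partialDeriv_mul (hχ : IsTest Ω χ) {c : E n → ℝ} (hc : ContDiff ℝ ∞ c) (x : E n) :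
    KEqL.partialDeriv i (fun x => χ x * c x) x
      = χ x * KEqL.partialDeriv i c x + KEqL.partialDeriv i χ x * c x := by
  have := fderiv_fun_mul (hχ.contDiff.differentiable (by simp) x)
    (hc.differentiable (by simp) x)
  simp only [KEqL.partialDeriv, this, add_apply, smul_apply, smul_eq_mul]
  ring

lemma IsTest.integrable_mul (hχ : IsTest Ω χ) (hw : MemLp w 2 (volume.restrict Ω)) :
    Integrable (fun x => w x * χ x) (volume.restrict Ω) :=
  hw.integrable_mul (q := 2) (hχ.contDiff.continuous.memLp_of_hasCompactSupport hχ.compact)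

/-- The product rule `∂ᵢ(χ w) = χ w' + ∂ᵢχ w` on `ℝⁿ`, tested with a smooth function that need not
have compact support. -/
lemma IsWeakPartial.integral_mul (h : IsWeakPartial Ω i w w')
    (hw : MemLp w 2 (volume.restrict Ω)) (hw' : MemLp w' 2 (volume.restrict Ω))
    (hχ : IsTest Ω χ) {c : E n → ℝ} (hc : ContDiff ℝ ∞ c) :
    ∫ x, (χ x * w x * partialDeriv i c x + (χ x * w' x + partialDeriv i χ x * w x) * c x) = 0 := by
  have hc' : ContDiff ℝ ∞ (partialDeriv i c) :=
    (hc.fderiv_right (m := ∞) (by simp)).clm_apply contDiff_const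
  have hweak := h _ (hχ.mul_contDiff hc)
  simp only [hχ.partialDeriv_mul hc, mul_add] at hweak
  have hint := ((hχ.mul_contDiff hc').integrable_mul hw).fun_add
    (((hχ.partialDeriv i).mul_contDiff hc).integrable_mul hw)
  rw [← add_eq_zero_iff_eq_neg, ← integral_add hint ((hχ.mul_contDiff hc).integrable_mul hw')]
    at hweak
  rw [← hweak, setIntegral_eq_integral_of_forall_compl_eq_zero fun x hx => by
    simp only [hχ.eq_zero hx, (hχ.partialDeriv i).eq_zero hx, zero_mul, mul_zero, add_zero]]
  exact integral_congr_ae (.of_forall fun x => by simp only []; ring)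

lemma IsWeakPartial.integral_cut_mul (h : IsWeakPartial Ω i w w')
    (hw : MemLp w 2 (volume.restrict Ω)) (hw' : MemLp w' 2 (volume.restrict Ω))
    (hχ : IsTest Ω χ) {c : E n → ℂ} (hc : ContDiff ℝ ∞ c) :
    ∫ x, (cut χ w x * fderiv ℝ c x (EuclideanSpace.single i 1)
      + (cut χ w' x + cut (partialDeriv i χ) w x) * c x) = 0 := by
  have hcd : Continuous fun x => fderiv ℝ c x (EuclideanSpace.single i 1) :=
    ((hc.fderiv_right (m := ∞) (by simp)).clm_apply contDiff_const).continuous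
  have hint : Integrable fun x => cut χ w x * fderiv ℝ c x (EuclideanSpace.single i 1)
      + (cut χ w' x + cut (partialDeriv i χ) w x) * c x := by
    simp only [add_mul]
    exact (integrable_cut_mul hχ hw hcd).add ((integrable_cut_mul hχ hw' hc.continuous).add
      (integrable_cut_mul (hχ.partialDeriv i) hw hc.continuous))
  have hcomp : ∀ (T : ℂ →L[ℝ] ℝ) (x : E n), partialDeriv i (T ∘ c) x
      = T (fderiv ℝ c x (EuclideanSpace.single i 1)) := fun T x =>
    DFunLike.congr_fun (T.hasFDerivAt.comp x (hc.differentiable (by simp) x).hasFDerivAt).fderiv _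
  apply Complex.ext
  · refine (integral_re hint).symm.trans
      (.trans ?_ (h.integral_mul hw hw' hχ (Complex.reCLM.contDiff.comp hc)))
    simp [hcomp, cut]
  · refine (integral_im hint).symm.trans
      (.trans ?_ (h.integral_mul hw hw' hχ (Complex.imCLM.contDiff.comp hc)))
    simp [hcomp, cut]

lemma fourier_cut_partialDeriv (h : IsWeakPartial Ω i w w')
    (hw : MemLp w 2 (volume.restrict Ω)) (hw' : MemLp w' 2 (volume.restrict Ω))
    (hχ : IsTest Ω χ) (ξ : E n) :
    2 * Real.pi * Complex.I * (ξ i * 𝓕 (cut χ w) ξ)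
      = 𝓕 (cut χ w') ξ + 𝓕 (cut (partialDeriv i χ) w) ξ := by
  set c : E n → ℂ := fun x => Real.fourierChar (-⟪x, ξ⟫) with hc
  have hc_contDiff : ContDiff ℝ ∞ c := by
    simp only [hc, Real.fourierChar_apply]
    have hphase : ContDiff ℝ ∞ fun x : E n => 2 * Real.pi * -⟪x, ξ⟫ :=
      contDiff_const.mul (contDiff_id.inner ℝ contDiff_const).neg
    exact ((Complex.ofRealCLM.contDiff.comp hphase).mul contDiff_const).cexp
  have hc_deriv : ∀ x, fderiv ℝ c x (EuclideanSpace.single i 1)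
      = -(2 * Real.pi * Complex.I * ξ i) * c x := fun x => by
    have hchar : fderiv ℝ c x (EuclideanSpace.single i 1) =
        -2 * Real.pi * Complex.I * ⟪EuclideanSpace.single i (1 : ℝ), ξ⟫ * c x :=
      Real.fderiv_fourierChar_neg_bilinear_left_apply (innerSL ℝ (E := E n)) x _ ξ
    rw [hchar, EuclideanSpace.inner_single_left, map_one, one_mul]
    ring
  have hfourier : ∀ h : E n → ℂ, 𝓕 h ξ = ∫ x, h x * c x := fun h => by
    simp only [Real.fourier_eq, Circle.smul_def, smul_eq_mul, hc, mul_comm]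
  have hparts := h.integral_cut_mul hw hw' hχ hc_contDiff
  have hint : ∀ {χ w : E n → ℝ}, IsTest Ω χ → MemLp w 2 (volume.restrict Ω) →
      Integrable fun x => cut χ w x * c x := fun hχ hw =>
    integrable_cut_mul hχ hw hc_contDiff.continuous
  simp only [hc_deriv, add_mul, mul_left_comm (cut χ w _)] at hparts
  rw [integral_add ((hint hχ hw).const_mul _) ((hint hχ hw').fun_add (hint (hχ.partialDeriv i) hw)),
    integral_add (hint hχ hw') (hint (hχ.partialDeriv i) hw), integral_const_mul, ← hfourier,
    ← hfourier, ← hfourier] at hparts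
  linear_combination -hparts

/-- By induction on `k`, commuting the weight `ξᵢ` through the Fourier transform one weak
derivative at a time; the cutoff varies because each step also differentiates it. -/
lemma memLp_pow_mul_fourier_cut (hΩ : IsOpen Ω) (k : ℕ) :
    ∀ {χ : E n → ℝ} {w : ℕ → E n → ℝ}, IsTest Ω χ →
      (∀ j ≤ k, MemLp (w j) 2 (volume.restrict Ω)) →
      (∀ j < k, IsWeakPartial Ω i (w j) (w (j + 1))) →
      MemLp (fun ξ => (ξ i : ℂ) ^ k * 𝓕 (cut χ (w 0)) ξ) 2 := by
  induction k with
  | zero =>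
    intro χ w hχ hw _
    simpa only [pow_zero, one_mul] using
      memLp_fourier (integrable_cut hχ (hw 0 le_rfl)) (memLp_cut hΩ hχ (hw 0 le_rfl))
  | succ k ih =>
    intro χ w hχ hw hd
    have hw' := ih hχ (w := fun j => w (j + 1)) (fun j hj => hw _ (by lia))
      fun j hj => hd _ (by lia)
    have hχ' := ih (hχ.partialDeriv i) (w := w) (fun j hj => hw _ (by lia))
      fun j hj => hd _ (by lia)
    refine ((hw'.add hχ').const_mul (2 * Real.pi * Complex.I)⁻¹).ae_eq (.of_forall fun ξ => ?_)
    have hstep := fourier_cut_partialDeriv (hd 0 (by lia)) (hw 0 (by lia)) (hw 1 (by lia)) hχ ξ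
    simp only [Pi.add_apply, zero_add]
    rw [← mul_add, ← hstep, pow_succ]
    field_simp [Complex.two_pi_I_ne_zero]

end WeakDerivative

section SobolevFourier

variable {n k : ℕ} {Ω : Set (E n)} {χ f g : E n → ℝ}

/-- The function `f` belongs to the Sobolev space `H^k(Ω)`. -/
def MemSobolev (k : ℕ) (Ω : Set (E n)) (f : E n → ℝ) : Prop :=
  ∃ w : SobolevSpace k Ω, Represents w f

lemma multiDeriv_single (i : Fin n) (j : ℕ) (φ : E n → ℝ) :
    multiDeriv (Pi.single i j) φ = (partialDeriv i)^[j] φ := by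
  suffices h : ∀ l : List (Fin n), l.Nodup →
      l.foldr (fun i' g => (partialDeriv i')^[(Pi.single i j : Fin n → ℕ) i'] g) φ
        = if i ∈ l then (partialDeriv i)^[j] φ else φ by
    rw [multiDeriv, h _ (List.nodup_finRange n), if_pos (List.mem_finRange i)]
  intro l hl
  induction l with
  | nil => simp
  | cons a l ih =>
    rw [List.nodup_cons] at hl
    rw [List.foldr_cons, ih hl.2]
    obtain rfl | hai := eq_or_ne a i
    · simp [hl.1]
    · simp [hai.symm]

lemma single_mem_multiIdx {j : ℕ} (hj : j ≤ k) (i : Fin n) : Pi.single i j ∈ multiIdx n k := by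
  simpa [mem_multiIdx] using hj

/-- The weak derivative `∂ᵢʲ w` of an element `w` of `H^k(Ω)` (and `0` for `j > k`). -/
noncomputable def pureDeriv (w : SobolevSpace k Ω) (i : Fin n) (j : ℕ) :
    Lp ℝ 2 (volume.restrict Ω) :=
  if h : j ≤ k then w.1 ⟨Pi.single i j, single_mem_multiIdx h i⟩ else 0

lemma pureDeriv_zero (w : SobolevSpace k Ω) (i : Fin n) :
    pureDeriv w i 0 = w.1 (zeroIdx n k) := by
  simp [pureDeriv, zeroIdx]

lemma integral_mul_iterate_partialDeriv (w : SobolevSpace k Ω) (i : Fin n) {j : ℕ} (hj : j ≤ k)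
    {φ : E n → ℝ} (hφ : IsTest Ω φ) :
    ∫ x in Ω, w.1 (zeroIdx n k) x * (partialDeriv i)^[j] φ x
      = (-1) ^ j * ∫ x in Ω, pureDeriv w i j x * φ x := by
  have hweak := w.2 ⟨Pi.single i j, single_mem_multiIdx hj i⟩ φ hφ
  simp only [multiDeriv_single] at hweak
  rw [hweak, pureDeriv, dif_pos hj]
  simp

lemma isWeakPartial_pureDeriv (w : SobolevSpace k Ω) (i : Fin n) {j : ℕ} (hj : j < k) :
    IsWeakPartial Ω i (pureDeriv w i j) (pureDeriv w i (j + 1)) := by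
  intro φ hφ
  have hsucc := integral_mul_iterate_partialDeriv w i hj hφ
  rw [Function.iterate_succ_apply, integral_mul_iterate_partialDeriv w i hj.le (hφ.partialDeriv i),
    pow_succ, mul_assoc, neg_one_mul] at hsucc
  exact mul_left_cancel₀ (pow_ne_zero j (by norm_num)) hsucc

lemma norm_le_sum_abs (ξ : E n) : ‖ξ‖ ≤ ∑ i, |ξ i| := by
  conv_lhs => rw [← (EuclideanSpace.basisFun (Fin n) ℝ).sum_repr ξ]
  refine (norm_sum_le _ _).trans_eq (Finset.sum_congr rfl fun i _ => ?_)
  simp [norm_smul]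

lemma one_add_norm_pow_le (k : ℕ) (ξ : E n) :
    (1 + ‖ξ‖) ^ k ≤ ((n : ℝ) + 1) ^ (k - 1) * (1 + ∑ i, |ξ i| ^ k) := by
  cases k with
  | zero => simp
  | succ k =>
    calc (1 + ‖ξ‖) ^ (k + 1) ≤ (1 + ∑ i, |ξ i|) ^ (k + 1) := by gcongr; exact norm_le_sum_abs ξ
      _ = (∑ o : Option (Fin n), o.elim 1 fun i => |ξ i|) ^ (k + 1) := by
        simp [Fintype.sum_option]
      _ ≤ _ := pow_sum_le_card_mul_sum_pow (fun o _ => by cases o <;> simp) k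
      _ = _ := by simp [Fintype.sum_option]

lemma memLp_weight_mul_fourier_cut (hΩ : IsOpen Ω) (hχ : IsTest Ω χ) (w : SobolevSpace k Ω) :
    MemLp (fun ξ => (1 + ‖ξ‖) ^ k • 𝓕 (cut χ (w.1 (zeroIdx n k))) ξ) 2 := by
  set F := 𝓕 (cut χ (w.1 (zeroIdx n k))) 
  have hFc : Continuous F := continuous_fourier (integrable_cut hχ (Lp.memLp _))
  have hF2 : MemLp F 2 :=
    memLp_fourier (integrable_cut hχ (Lp.memLp _)) (memLp_cut hΩ hχ (Lp.memLp _))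
  have hpure : ∀ i, MemLp (fun ξ : E n => (ξ i : ℂ) ^ k * F ξ) 2 := fun i => by
    have := memLp_pow_mul_fourier_cut hΩ k hχ (w := fun j => pureDeriv w i j)
      (fun _ _ => Lp.memLp _) fun j hj => isWeakPartial_pureDeriv w i hj
    rwa [pureDeriv_zero] at this
  refine (hF2.norm.add (memLp_finsetSum Finset.univ fun i _ => (hpure i).norm)).of_le_mul
    (c := ((n : ℝ) + 1) ^ (k - 1)) (Continuous.aestronglyMeasurable (by fun_prop))
    (.of_forall fun ξ => ?_)
  have hsum : 0 ≤ ‖F ξ‖ + ∑ i, ‖(ξ i : ℂ) ^ k * F ξ‖ := by positivity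
  calc ‖(1 + ‖ξ‖) ^ k • F ξ‖ = (1 + ‖ξ‖) ^ k * ‖F ξ‖ := by
        rw [norm_smul, Real.norm_of_nonneg (by positivity)]
    _ ≤ ((n : ℝ) + 1) ^ (k - 1) * (1 + ∑ i, |ξ i| ^ k) * ‖F ξ‖ := by
        gcongr; exact one_add_norm_pow_le k ξ
    _ = ((n : ℝ) + 1) ^ (k - 1) * ‖‖F ξ‖ + ∑ i, ‖(ξ i : ℂ) ^ k * F ξ‖‖ := by
        rw [Real.norm_of_nonneg hsum]
        simp only [norm_mul, norm_pow, Complex.norm_real, Real.norm_eq_abs, ← Finset.sum_mul]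
        ring

end SobolevFourier

section Barron

variable {n k : ℕ} {Ω : Set (E n)} {χ f : E n → ℝ} {F : E n → ℂ} {r s : ℝ} {i : Fin n}

/-- The spectral Barron class of order `r`: `f` is the Fourier integral of a function `F` with
`∫ (1 + ‖ξ‖)^r ‖F ξ‖ dξ < ∞`. Membership of order `r` gives bounded derivatives up to order `r`
with a Hölder modulus, and the class is closed under differentiation. -/
def IsBarron (r : ℝ) (f : E n → ℝ) : Prop :=
  ∃ F : E n → ℂ, Integrable (fun ξ => (1 + ‖ξ‖) ^ r • F ξ) ∧ ∀ x, f x = (𝓕 F x).re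

lemma integrable_weight_smul_of_le (hF : Integrable fun ξ => (1 + ‖ξ‖) ^ r • F ξ) (h : s ≤ r) :
    Integrable fun ξ => (1 + ‖ξ‖) ^ s • F ξ := by
  have hsplit : (fun ξ => (1 + ‖ξ‖) ^ s • F ξ)
      = fun ξ => (1 + ‖ξ‖) ^ (s - r) • (1 + ‖ξ‖) ^ r • F ξ := by
    funext ξ
    rw [smul_smul, ← Real.rpow_add (by positivity), sub_add_cancel]
  have hcont : Continuous fun ξ : E n => (1 + ‖ξ‖) ^ (s - r) :=
    Continuous.rpow_const (by fun_prop) fun ξ => .inl (by positivity)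
  rw [hsplit]
  refine hF.mono (hcont.aestronglyMeasurable.smul hF.1) (.of_forall fun ξ => ?_)
  rw [norm_smul, Real.norm_of_nonneg (by positivity)]
  exact mul_le_of_le_one_left (norm_nonneg _)
    (Real.rpow_le_one_of_one_le_of_nonpos (by simp) (by linarith))

lemma integrable_of_weight_smul (hF : Integrable fun ξ => (1 + ‖ξ‖) ^ r • F ξ) (hr : 0 ≤ r) :
    Integrable F := by
  simpa only [Real.rpow_zero, one_smul] using integrable_weight_smul_of_le hF hr

lemma integrable_weight_mul_of_norm_le {G : E n → ℂ} {c : ℝ}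
    (hF : Integrable fun ξ => (1 + ‖ξ‖) ^ r • F ξ) (hG : AEStronglyMeasurable G)
    (hle : ∀ ξ, ‖G ξ‖ ≤ c * (1 + ‖ξ‖) ^ s * ‖F ξ‖) :
    Integrable fun ξ => (1 + ‖ξ‖) ^ (r - s) • G ξ := by
  have hcont : Continuous fun ξ : E n => (1 + ‖ξ‖) ^ (r - s) :=
    Continuous.rpow_const (by fun_prop) fun ξ => .inl (by positivity)
  refine (hF.norm.const_mul c).mono' (hcont.aestronglyMeasurable.smul hG) (.of_forall fun ξ => ?_)
  rw [norm_smul, norm_smul, Real.norm_of_nonneg (by positivity),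
    Real.norm_of_nonneg (by positivity)]
  calc (1 + ‖ξ‖) ^ (r - s) * ‖G ξ‖
      ≤ (1 + ‖ξ‖) ^ (r - s) * (c * (1 + ‖ξ‖) ^ s * ‖F ξ‖) := by gcongr; exact hle ξ
    _ = c * ((1 + ‖ξ‖) ^ (r - s) * (1 + ‖ξ‖) ^ s * ‖F ξ‖) := by ring
    _ = _ := by rw [← Real.rpow_add (by positivity), sub_add_cancel]

lemma integrable_norm_mul_of_weight_smul (hF : Integrable fun ξ => (1 + ‖ξ‖) ^ r • F ξ)
    (hr : 1 ≤ r) : Integrable fun ξ => ‖ξ‖ * ‖F ξ‖ := by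
  have hF0 := integrable_of_weight_smul hF (zero_le_one.trans hr)
  refine (integrable_weight_smul_of_le hF hr).mono
    (continuous_norm.aestronglyMeasurable.mul hF0.1.norm) (.of_forall fun ξ => ?_)
  rw [Real.rpow_one, norm_smul, Real.norm_of_nonneg (by positivity),
    Real.norm_of_nonneg (by positivity)]
  gcongr
  linarith

lemma hasFDerivAt_re_fourier (hr : 1 ≤ r) (hF : Integrable fun ξ => (1 + ‖ξ‖) ^ r • F ξ)
    (hfF : ∀ x, f x = (𝓕 F x).re) (x : E n) :
    HasFDerivAt f (Complex.reCLM ∘L 𝓕 (VectorFourier.fourierSMulRight (innerSL ℝ) F) x) x := by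
  rw [show f = Complex.reCLM ∘ 𝓕 F from funext hfF]
  exact Complex.reCLM.hasFDerivAt.comp x (Real.hasFDerivAt_fourier
    (integrable_of_weight_smul hF (zero_le_one.trans hr))
    (integrable_norm_mul_of_weight_smul hF hr) x)

lemma IsBarron.differentiable (hf : IsBarron r f) (hr : 1 ≤ r) : Differentiable ℝ f := by
  obtain ⟨F, hF, hfF⟩ := hf
  exact fun x => (hasFDerivAt_re_fourier hr hF hfF x).differentiableAt

lemma IsBarron.partialDeriv (hf : IsBarron r f) (hr : 1 ≤ r) (i : Fin n) :
    IsBarron (r - 1) (partialDeriv i f) := by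
  obtain ⟨F, hF, hfF⟩ := hf
  have hFm := (integrable_of_weight_smul hF (zero_le_one.trans hr)).1
  have hmul : Integrable (VectorFourier.fourierSMulRight (innerSL ℝ) F) := by
    refine ((integrable_norm_mul_of_weight_smul hF hr).const_mul
      (2 * Real.pi * ‖innerSL ℝ (E := E n)‖)).mono' hFm.fourierSMulRight ?_
    exact .of_forall fun ξ => (VectorFourier.norm_fourierSMulRight_le _ F ξ).trans_eq (by ring)
  refine ⟨fun ξ => -(2 * Real.pi * Complex.I) * ξ i * F ξ, ?_, fun x => ?_⟩
  · have hmeas : AEStronglyMeasurable fun ξ : E n => -(2 * Real.pi * Complex.I) * ξ i * F ξ :=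
      (Continuous.aestronglyMeasurable (by fun_prop)).mul hFm
    refine integrable_weight_mul_of_norm_le (c := 2 * Real.pi) hF hmeas fun ξ => ?_
    have hξ : |ξ i| ≤ 1 + ‖ξ‖ := (PiLp.norm_apply_le ξ i).trans (by linarith)
    simp only [norm_mul, norm_neg, Complex.norm_I, Complex.norm_real, Real.norm_eq_abs,
      abs_of_pos Real.pi_pos, mul_one, Complex.norm_two, Real.rpow_one]
    gcongr
  · rw [KEqL.partialDeriv, (hasFDerivAt_re_fourier hr hF hfF x).fderiv,
      ContinuousLinearMap.comp_apply, Real.fourier_continuousLinearMap_apply hmul,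
      Complex.reCLM_apply]
    refine congrArg Complex.re (congrFun (congrArg 𝓕 (funext fun ξ => ?_)) x)
    simp only [VectorFourier.fourierSMulRight_apply, innerSL_apply_apply ℝ,
      EuclideanSpace.inner_single_right, Complex.real_smul, smul_eq_mul]
    simp [mul_assoc]

end Barron

section LocallyBarron

variable {n k : ℕ} {Ω : Set (E n)} {χ f g : E n → ℝ} {r s : ℝ}

lemma norm_exp_I_mul_ofReal_sub_one_le_rpow (hs : 0 ≤ s) (hs1 : s ≤ 1) (θ : ℝ) :
    ‖Complex.exp (Complex.I * θ) - 1‖ ≤ 2 * |θ| ^ s := by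
  obtain hθ | hθ := le_total |θ| 1
  · calc ‖Complex.exp (Complex.I * θ) - 1‖ ≤ |θ| := Real.norm_exp_I_mul_ofReal_sub_one_le
      _ ≤ |θ| ^ s := Real.self_le_rpow_of_le_one (abs_nonneg θ) hθ hs1
      _ ≤ 2 * |θ| ^ s := le_mul_of_one_le_left (by positivity) one_le_two
  · calc ‖Complex.exp (Complex.I * θ) - 1‖ ≤ 2 * 1 := by
          refine (norm_sub_le _ _).trans_eq ?_
          rw [mul_comm, Complex.norm_exp_ofReal_mul_I, norm_one]
          norm_num
      _ ≤ 2 * |θ| ^ s := by gcongr; exact Real.one_le_rpow hθ hs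

lemma norm_fourierChar_sub_le (hs : 0 ≤ s) (hs1 : s ≤ 1) (ξ x y : E n) :
    ‖(Real.fourierChar (-⟪ξ, x⟫) : ℂ) - Real.fourierChar (-⟪ξ, y⟫)‖
      ≤ 2 * (2 * Real.pi) ^ s * ‖x - y‖ ^ s * (1 + ‖ξ‖) ^ s := by
  have hfactor : (Real.fourierChar (-⟪ξ, x⟫) : ℂ) - Real.fourierChar (-⟪ξ, y⟫)
      = Real.fourierChar (-⟪ξ, y⟫)
        * (Complex.exp (Complex.I * (2 * Real.pi * ⟪ξ, y - x⟫ : ℝ)) - 1) := by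
    simp only [Real.fourierChar_apply, mul_sub, ← Complex.exp_add, mul_one, inner_sub_right]
    congr 2
    push_cast
    ring
  have hθ : |2 * Real.pi * ⟪ξ, y - x⟫| ≤ 2 * Real.pi * (‖x - y‖ * (1 + ‖ξ‖)) := by
    rw [abs_mul, abs_of_pos Real.two_pi_pos, norm_sub_rev, mul_comm ‖y - x‖]
    gcongr
    exact (abs_real_inner_le_norm _ _).trans (by gcongr; linarith)
  rw [hfactor, norm_mul, Circle.norm_coe, one_mul]
  calc _ ≤ 2 * |2 * Real.pi * ⟪ξ, y - x⟫| ^ s := norm_exp_I_mul_ofReal_sub_one_le_rpow hs hs1 _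
    _ ≤ 2 * (2 * Real.pi * (‖x - y‖ * (1 + ‖ξ‖))) ^ s := by gcongr
    _ = _ := by
      rw [Real.mul_rpow Real.two_pi_pos.le (by positivity),
        Real.mul_rpow (norm_nonneg _) (by positivity)]
      ring

lemma IsBarron.exists_abs_sub_le (hf : IsBarron s f) (hs : 0 ≤ s) (hs1 : s ≤ 1) :
    ∃ C, ∀ x y, |f x - f y| ≤ C * ‖x - y‖ ^ s := by
  obtain ⟨F, hF, hfF⟩ := hf
  have hF0 := integrable_of_weight_smul hF hs
  have hint : ∀ x, Integrable fun ξ => Real.fourierChar (-⟪ξ, x⟫) • F ξ := fun x =>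
    (Real.fourierIntegral_convergent_iff x).2 hF0
  refine ⟨2 * (2 * Real.pi) ^ s * ∫ ξ, ‖(1 + ‖ξ‖) ^ s • F ξ‖, fun x y => ?_⟩
  calc |f x - f y| = |(𝓕 F x - 𝓕 F y).re| := by rw [hfF, hfF, Complex.sub_re]
    _ ≤ ‖𝓕 F x - 𝓕 F y‖ := Complex.abs_re_le_norm _
    _ = ‖∫ ξ, (Real.fourierChar (-⟪ξ, x⟫) • F ξ - Real.fourierChar (-⟪ξ, y⟫) • F ξ)‖ := by
      rw [integral_sub (hint x) (hint y), Real.fourier_eq, Real.fourier_eq]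
    _ ≤ ∫ ξ, 2 * (2 * Real.pi) ^ s * ‖x - y‖ ^ s * ‖(1 + ‖ξ‖) ^ s • F ξ‖ := by
      refine norm_integral_le_of_norm_le (hF.norm.const_mul _) (.of_forall fun ξ => ?_)
      rw [Circle.smul_def, Circle.smul_def, ← sub_smul, norm_smul, norm_smul ((1 + ‖ξ‖) ^ s),
        Real.norm_of_nonneg (by positivity), ← mul_assoc]
      gcongr
      exact norm_fourierChar_sub_le hs hs1 ξ x y
    _ = _ := by rw [integral_const_mul]; ring

/-- Near each point of `Ω`, the function `f` coincides with a function of the Barron class of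
order `r`. -/
def IsLocallyBarron (r : ℝ) (Ω : Set (E n)) (f : E n → ℝ) : Prop :=
  ∀ x ∈ Ω, ∃ g, IsBarron r g ∧ f =ᶠ[𝓝 x] g

lemma IsLocallyBarron.differentiableAt (hf : IsLocallyBarron r Ω f) (hr : 1 ≤ r) {x : E n}
    (hx : x ∈ Ω) : DifferentiableAt ℝ f x := by
  obtain ⟨g, hg, hfg⟩ := hf x hx
  exact (hg.differentiable hr x).congr_of_eventuallyEq hfg

lemma IsLocallyBarron.partialDeriv (hf : IsLocallyBarron r Ω f) (hr : 1 ≤ r) (i : Fin n) :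
    IsLocallyBarron (r - 1) Ω (partialDeriv i f) := fun x hx => by
  obtain ⟨g, hg, hfg⟩ := hf x hx
  exact ⟨_, hg.partialDeriv hr i, hfg.fderiv.fun_comp fun T => T (EuclideanSpace.single i 1)⟩

lemma IsLocallyBarron.foldr_partialDeriv (hf : IsLocallyBarron r Ω f) {l : List (Fin n)}
    (hl : l.length ≤ r) : IsLocallyBarron (r - l.length) Ω (l.foldr KEqL.partialDeriv f) := by
  induction l with
  | nil => simpa using hf
  | cons i l ih =>
    rw [List.length_cons, Nat.cast_succ] at hl ⊢
    rw [← sub_sub]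
    exact (ih (by linarith)).partialDeriv (by linarith) i

lemma IsBarron.of_le (hf : IsBarron r f) (h : s ≤ r) : IsBarron s f :=
  let ⟨F, hF, hfF⟩ := hf
  ⟨F, integrable_weight_smul_of_le hF h, hfF⟩

lemma IsLocallyBarron.isBigO_sub (hf : IsLocallyBarron r Ω f) (hr : 0 ≤ r) {x : E n}
    (hx : x ∈ Ω) : (fun y => f y - f x) =O[𝓝 x] fun y => ‖y - x‖ ^ min r 1 := by
  obtain ⟨g, hg, hfg⟩ := hf x hx
  obtain ⟨C, hC⟩ := (hg.of_le (min_le_left r 1)).exists_abs_sub_le (by positivity)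
    (min_le_right r 1)
  refine .of_bound C ?_
  filter_upwards [hfg] with y hy
  rw [hy, hfg.self_of_nhds, Real.norm_of_nonneg (r := ‖y - x‖ ^ min r 1) (by positivity)]
  exact hC y x

lemma cut_ae_eq (hΩ : IsOpen Ω) (hχ : IsTest Ω χ) {w : E n → ℝ}
    (hw : w =ᵐ[volume.restrict Ω] f) : cut χ w =ᵐ[volume] cut χ f := by
  filter_upwards [(ae_restrict_iff' hΩ.measurableSet).1 hw] with x hx
  by_cases hxΩ : x ∈ Ω
  · rw [cut, cut, hx hxΩ]
  · rw [cut_eq_zero hχ hxΩ, cut_eq_zero hχ hxΩ]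

lemma continuous_cut (hΩ : IsOpen Ω) (hχ : IsTest Ω χ) (hf : ContinuousOn f Ω) :
    Continuous (cut χ f) :=
  Complex.continuous_ofReal.comp <|
    (hχ.contDiff.continuous.continuousOn.mul hf).continuous_of_tsupport_subset hΩ
      ((tsupport_mul_subset_left (f := χ) (g := f)).trans hχ.subset)

lemma integrable_weight_smul_of_memLp {F : E n → ℂ} (hr : r + n / 2 < k)
    (hF : MemLp (fun ξ => (1 + ‖ξ‖) ^ k • F ξ) 2) :
    Integrable fun ξ => (1 + ‖ξ‖) ^ r • F ξ := by
  have hcont : Continuous fun ξ : E n => (1 + ‖ξ‖) ^ (r - k) :=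
    Continuous.rpow_const (by fun_prop) fun ξ => .inl (by positivity)
  have hweight : MemLp (fun ξ : E n => (1 + ‖ξ‖) ^ (r - k)) 2 := by
    rw [memLp_two_iff_integrable_sq hcont.aestronglyMeasurable]
    have hdim : (Module.finrank ℝ (E n) : ℝ) < 2 * (k - r) := by
      rw [finrank_euclideanSpace_fin]
      linarith
    refine (integrable_one_add_norm hdim).congr (.of_forall fun ξ => ?_)
    simp only [← Real.rpow_mul_natCast (show 0 ≤ 1 + ‖ξ‖ by positivity)]
    congr 1
    push_cast
    ring
  refine (memLp_one_iff_integrable.1 (hF.smul (r := 1) hweight)).congr (.of_forall fun ξ => ?_)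
  simp only [Pi.smul_apply', smul_smul]
  rw [← Real.rpow_natCast, ← Real.rpow_add (by positivity), sub_add_cancel]

lemma isBarron_mul_of_memSobolev (hΩ : IsOpen Ω) (hf : ContinuousOn f Ω) (hfk : MemSobolev k Ω f)
    (hr : r + n / 2 < k) (hr0 : 0 ≤ r) (hχ : IsTest Ω χ) : IsBarron r fun x => χ x * f x := by
  obtain ⟨w, hw⟩ := hfk
  have hcut := cut_ae_eq hΩ hχ hw
  have hcutL2 := memLp_weight_mul_fourier_cut hΩ hχ w
  simp only [Real.fourier_congr_ae hcut] at hcutL2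
  have hweight := integrable_weight_smul_of_memLp hr hcutL2
  refine ⟨fun ξ => 𝓕 (cut χ f) (-ξ), by simpa only [norm_neg] using hweight.comp_neg, fun x => ?_⟩
  have hinv := (continuous_cut hΩ hχ hf).fourierInv_fourier_eq
    ((integrable_cut hχ (Lp.memLp _)).congr hcut) (integrable_of_weight_smul hweight hr0)
  rw [← Real.fourierInv_eq_fourier_comp_neg, hinv, cut, Complex.ofReal_re]

lemma isLocallyBarron_of_memSobolev (hΩ : IsOpen Ω) (hf : ContinuousOn f Ω)
    (hfk : MemSobolev k Ω f) (hr : r + n / 2 < k) (hr0 : 0 ≤ r) : IsLocallyBarron r Ω f := by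
  intro x hx
  obtain ⟨ε, hε, hball⟩ := Metric.isOpen_iff.1 hΩ x hx
  let χ : ContDiffBump x := ⟨ε / 4, ε / 2, by positivity, by linarith⟩
  have hχ : IsTest Ω χ :=
    ⟨χ.contDiff, χ.hasCompactSupport, χ.tsupport_eq.trans_subset
      ((Metric.closedBall_subset_ball (half_lt_self hε)).trans hball)⟩
  refine ⟨_, isBarron_mul_of_memSobolev hΩ hf hfk hr hr0 hχ, ?_⟩
  filter_upwards [χ.eventuallyEq_one] with y hy
  rw [hy, Pi.one_apply, one_mul]

end LocallyBarron

section Jets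

variable {n k p : ℕ} {Ω : Set (E n)} {r : ℝ}
  {H : Type*} [NormedAddCommGroup H] [InnerProductSpace ℝ H] [CompleteSpace H]

/-- The form in which one can induct on the order of the derivative. -/
lemma exists_multiDeriv_eq_foldr (α : Fin n → ℕ) :
    ∃ l : List (Fin n), l.length = ∑ i, α i ∧
      ∀ f, multiDeriv α f = l.foldr partialDeriv f := by
  refine ⟨(List.finRange n).flatMap fun i => List.replicate (α i) i, ?_, fun f => ?_⟩
  · simp [List.length_flatMap, Fin.sum_univ_def]
  · have hiter : ∀ (i : Fin n) (j : ℕ) (f : E n → ℝ),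
        (List.replicate j i).foldr partialDeriv f = (partialDeriv i)^[j] f := fun i j f => by
      induction j with
      | zero => rfl
      | succ j ih => rw [List.replicate_succ, List.foldr_cons, ih, Function.iterate_succ_apply']
    rw [List.foldr_flatMap, multiDeriv]
    simp only [hiter]

/-- The values `F v x` of the functions `F v` on `Ω` are bounded linear functionals of `v`,
given by their Riesz representatives `κ`. -/
def HasPointEvaluations (F : H → E n → ℝ) (Ω : Set (E n)) : Prop :=
  ∀ x ∈ Ω, ∃ κ : H, ∀ v, ⟪κ, v⟫ = F v x

lemma HasPointEvaluations.partialDeriv {F : H → E n → ℝ} (hF : HasPointEvaluations F Ω)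
    (hΩ : IsOpen Ω) (hd : ∀ v, ∀ x ∈ Ω, DifferentiableAt ℝ (F v) x) (i : Fin n) :
    HasPointEvaluations (fun v => partialDeriv i (F v)) Ω := by
  intro x hx
  choose! κ hκ using hF
  set e : E n := EuclideanSpace.single i 1
  set quotient : ℝ → H →L[ℝ] ℝ := fun t => innerSL ℝ (t⁻¹ • (κ (x + t • e) - κ x)) with hquotient
  have hmem : ∀ᶠ t : ℝ in 𝓝[≠] 0, x + t • e ∈ Ω := by
    refine Tendsto.eventually_mem (f := fun t : ℝ => x + t • e) ?_ (hΩ.mem_nhds hx)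
    exact (Continuous.tendsto' (by fun_prop) 0 x (by simp)).mono_left nhdsWithin_le_nhds
  have hlim : Tendsto (fun t v => quotient t v) (𝓝[≠] 0)
      (𝓝 fun v => KEqL.partialDeriv i (F v) x) := by
    refine tendsto_pi_nhds.2 fun v => (hasLineDerivAt_iff_tendsto_slope_zero.1
      ((hd v x hx).hasFDerivAt.hasLineDerivAt e)).congr' ?_
    filter_upwards [hmem] with t ht
    rw [hquotient, innerSL_apply_apply, real_inner_smul_left, inner_sub_left, hκ _ ht, hκ x hx,
      smul_eq_mul]
  exact ⟨(InnerProductSpace.toDual ℝ H).symm (continuousLinearMapOfTendsto quotient hlim),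
    fun v => InnerProductSpace.toDual_symm_apply⟩

lemma HasPointEvaluations.foldr_partialDeriv {F : H → E n → ℝ} (hF : HasPointEvaluations F Ω)
    (hΩ : IsOpen Ω) (hB : ∀ v, IsLocallyBarron r Ω (F v)) {l : List (Fin n)} (hl : l.length ≤ r) :
    HasPointEvaluations (fun v => l.foldr KEqL.partialDeriv (F v)) Ω := by
  induction l with
  | nil => exact hF
  | cons i l ih =>
    rw [List.length_cons, Nat.cast_succ] at hl
    refine (ih (by linarith)).partialDeriv hΩ (fun v x hx => ?_) i
    exact ((hB v).foldr_partialDeriv (by linarith)).differentiableAt (by linarith) hx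

lemma tendsto_zero_of_inner_isBigO {κ : ℕ → H} {a : ℕ → ℝ} (ha : Tendsto a atTop (𝓝 0))
    (ha0 : ∀ j, a j = 0 → κ j = 0) (hκ : ∀ v, (fun j => ⟪κ j, v⟫) =O[atTop] a) :
    Tendsto κ atTop (𝓝 0) := by
  obtain ⟨C, hC⟩ : ∃ C, ∀ j, ‖innerSL ℝ ((a j)⁻¹ • κ j)‖ ≤ C := by
    refine banach_steinhaus fun v => ?_
    obtain ⟨c, hc⟩ := (hκ v).bound
    have hbdd : IsBoundedUnder (· ≤ ·) atTop fun j => ‖innerSL ℝ ((a j)⁻¹ • κ j) v‖ := by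
      refine ⟨|c|, eventually_map.2 (hc.mono fun j hj => ?_)⟩
      rw [innerSL_apply_apply, real_inner_smul_left, norm_mul, norm_inv]
      exact inv_mul_le_of_le_mul₀ (norm_nonneg _) (abs_nonneg c)
        (hj.trans (by rw [mul_comm]; gcongr; exact le_abs_self c))
    obtain ⟨C, hC⟩ := hbdd.bddAbove_range
    exact ⟨C, fun j => hC ⟨j, rfl⟩⟩
  refine squeeze_zero_norm (a := fun j => C * |a j|) (fun j => ?_)
    (by simpa using ha.abs.const_mul C)
  obtain hj | hj := eq_or_ne (a j) 0
  · simp [ha0 j hj, hj]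
  · have := hC j
    rw [innerSL_apply_norm, norm_smul, norm_inv, inv_mul_le_iff₀ (by positivity)] at this
    rwa [mul_comm, ← Real.norm_eq_abs]

/-- The jet of order `p` of the functions `F v` on `Ω` is a bounded linear function of `v` whose
coefficients, as vectors of `H`, depend continuously on the point. -/
def HasContinuousJets (F : H → E n → ℝ) (p : ℕ) (Ω : Set (E n)) : Prop :=
  ∀ α ∈ multiIdx n p, ∃ κ : Ω → H, Continuous κ ∧ ∀ y v, ⟪κ y, v⟫ = multiDeriv α (F v) y

/-- Uniform boundedness turns the Hölder estimate for each function `F v` into one for the vectors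
representing the derivatives. -/
lemma HasPointEvaluations.hasContinuousJets {F : H → E n → ℝ} (hF : HasPointEvaluations F Ω)
    (hΩ : IsOpen Ω) (hr : p < r) (hB : ∀ v, IsLocallyBarron r Ω (F v)) :
    HasContinuousJets F p Ω := by
  intro α hα
  obtain ⟨l, hl, hlα⟩ := exists_multiDeriv_eq_foldr α
  have hlr : l.length < r := by
    refine lt_of_le_of_lt ?_ hr
    exact_mod_cast hl.trans_le (mem_multiIdx.1 hα)
  choose! κ hκ using hF.foldr_partialDeriv hΩ hB hlr.le
  refine ⟨fun y => κ y, ?_, fun y v => by rw [hκ y y.2, hlα]⟩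
  rw [continuous_iff_seqContinuous]
  intro y x hyx
  have hdist : Tendsto (fun j => ‖(y j : E n) - x‖) atTop (𝓝 0) :=
    tendsto_iff_norm_sub_tendsto_zero.1 ((continuous_subtype_val.tendsto x).comp hyx)
  set s := min (r - l.length) 1
  have hs : 0 < s := lt_min (sub_pos.2 hlr) one_pos
  refine tendsto_sub_nhds_zero_iff.1 (tendsto_zero_of_inner_isBigO
    (a := fun j => ‖(y j : E n) - x‖ ^ s) ?_ (fun j hj => ?_) fun v => ?_)
  · simpa only [Real.zero_rpow hs.ne'] using hdist.rpow_const (.inr hs.le)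
  · have hyx : y j = x := Subtype.ext <| sub_eq_zero.1 <| norm_eq_zero.1 <|
      ((Real.rpow_eq_zero (norm_nonneg _) hs.ne').1 hj)
    rw [Function.comp_apply, hyx, sub_self]
  · simp only [Function.comp_apply, inner_sub_left, hκ _ (Subtype.coe_prop _)]
    exact (((hB v).foldr_partialDeriv hlr.le).isBigO_sub (sub_nonneg.2 hlr.le) x.2).comp_tendsto
      ((continuous_subtype_val.tendsto x).comp hyx)

theorem HasPointEvaluations.hasContinuousJets_of_memSobolev {F : H → E n → ℝ}
    (hF : HasPointEvaluations F Ω) (hΩ : IsOpen Ω) (hcont : ∀ v, ContinuousOn (F v) Ω)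
    (hk : (n : ℝ) / 2 + p < k) (hsob : ∀ v, MemSobolev k Ω (F v)) : HasContinuousJets F p Ω := by
  obtain ⟨r, hpr, hrk⟩ := exists_between (lt_sub_iff_add_lt'.2 hk)
  exact hF.hasContinuousJets hΩ hpr fun v => isLocallyBarron_of_memSobolev hΩ (hcont v) (hsob v)
    (by linarith) ((Nat.cast_nonneg p).trans hpr.le)

end Jets

section WeakConvergence

variable {ι H G : Type*} [NormedAddCommGroup H] [InnerProductSpace ℝ H] [NormedAddCommGroup G]
  [InnerProductSpace ℝ G] {l : Filter ι} {x : ι → H} {a : H} {R : ℝ}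

/-- Weak convergence in a real inner product space along a filter. -/
def WeakTendsto (x : ι → H) (l : Filter ι) (a : H) : Prop :=
  ∀ y, Tendsto (fun i => ⟪y, x i⟫) l (𝓝 ⟪y, a⟫)

lemma weakTendsto_const (a : H) (l : Filter ι) : WeakTendsto (fun _ => a) l a :=
  fun _ => tendsto_const_nhds

lemma WeakTendsto.map [CompleteSpace H] [CompleteSpace G] (h : WeakTendsto x l a) (T : H →L[ℝ] G) :
    WeakTendsto (fun i => T (x i)) l (T a) := fun y => by
  simpa only [ContinuousLinearMap.adjoint_inner_left] using h (ContinuousLinearMap.adjoint T y)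

lemma WeakTendsto.tendsto_inner (h : WeakTendsto x l a) (hR : ∀ i, ‖x i‖ ≤ R) {κ : ι → H} {b : H}
    (hκ : Tendsto κ l (𝓝 b)) : Tendsto (fun i => ⟪κ i, x i⟫) l (𝓝 ⟪b, a⟫) := by
  have hsub : Tendsto (fun i => ⟪κ i - b, x i⟫) l (𝓝 0) := by
    have hlim := (tendsto_iff_norm_sub_tendsto_zero.1 hκ).mul_const R
    rw [zero_mul] at hlim
    exact squeeze_zero_norm (fun i => (norm_inner_le_norm _ _).trans (by gcongr; exact hR i)) hlim
  simpa only [← inner_add_left, add_sub_cancel, add_zero] using (h b).add hsub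

lemma exists_weakTendsto_ultrafilter [CompleteSpace H] (𝒰 : Ultrafilter ι)
    (hR : ∀ i, ‖x i‖ ≤ R) : ∃ a, WeakTendsto x 𝒰 a := by
  set φ : ι → WeakDual ℝ H := fun i => StrongDual.toWeakDual (InnerProductSpace.toDual ℝ H (x i))
  have hball : ↑(𝒰.map φ) ≤
      𝓟 (WeakDual.toStrongDual ⁻¹' Metric.closedBall (0 : StrongDual ℝ H) R) :=
    tendsto_principal.2 <| Eventually.of_forall fun i => by simpa [φ] using hR i
  obtain ⟨ψ, -, hψ⟩ := (WeakDual.isCompact_closedBall _ R).ultrafilter_le_nhds _ hball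
  refine ⟨(InnerProductSpace.toDual ℝ H).symm (WeakDual.toStrongDual ψ), fun y => ?_⟩
  have heval := ((WeakDual.eval_continuous y).tendsto ψ).comp (show Tendsto φ 𝒰 (𝓝 ψ) from hψ)
  rw [real_inner_comm, InnerProductSpace.toDual_symm_apply]
  exact heval.congr fun i => real_inner_comm _ _

lemma tendsto_of_norm_le_of_weakTendsto [CompleteSpace H] (hle : ∀ i, ‖x i‖ ≤ ‖a‖)
    (hlim : ∀ 𝒰 : Ultrafilter ι, ↑𝒰 ≤ l → ∀ c, WeakTendsto x 𝒰 c → ⟪a, c⟫ = ‖a‖ ^ 2) :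
    Tendsto x l (𝓝 a) := by
  refine (tendsto_iff_ultrafilter _ _ _).2 fun 𝒰 h𝒰 => ?_
  obtain ⟨c, hc⟩ := exists_weakTendsto_ultrafilter 𝒰 hle
  have hzero := ((hc a).const_sub (‖a‖ ^ 2)).const_mul 2
  rw [hlim 𝒰 h𝒰 c hc, sub_self, mul_zero] at hzero
  have hsq : Tendsto (fun i => ‖x i - a‖ ^ 2) 𝒰 (𝓝 0) := by
    refine squeeze_zero (fun i => by positivity) (fun i => ?_) hzero
    have := pow_le_pow_left₀ (norm_nonneg _) (hle i) 2
    rw [norm_sub_sq_real, real_inner_comm]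
    linarith
  rw [tendsto_iff_norm_sub_tendsto_zero]
  simpa [Real.sqrt_sq] using hsq.sqrt

end WeakConvergence

section ReproducingKernel

variable {X H : Type*} [NormedAddCommGroup H] [InnerProductSpace ℝ H] [CompleteSpace H]
  [RKHS ℝ H X ℝ]

variable (H) in
/-- The representer `K(x, ·)` of the evaluation at `x` in an RKHS of real-valued functions. -/
noncomputable def kerVec (x : X) : H := RKHS.kerFun H x 1

lemma inner_kerVec (x : X) (f : H) : ⟪kerVec H x, f⟫ = f x := by
  simp [kerVec, RKHS.kerFun_inner]

lemma inner_kerVec_kerVec (x y : X) : ⟪kerVec H x, kerVec H y⟫ = rkhsKernel H x y := by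
  rw [inner_kerVec, kerVec, RKHS.kerFun_apply, rkhsKernel]

lemma continuous_kerVec [TopologicalSpace X]
    (hK : Continuous fun y : X × X => rkhsKernel H y.1 y.2) : Continuous (kerVec H : X → H) := by
  refine continuous_iff_continuousAt.2 fun y => tendsto_iff_norm_sub_tendsto_zero.2 ?_
  have hnorm (x : X) : ‖kerVec H x - kerVec H y‖
      = √(rkhsKernel H x x - 2 * rkhsKernel H x y + rkhsKernel H y y) := by
    rw [← Real.sqrt_sq (norm_nonneg _), norm_sub_sq_real, ← real_inner_self_eq_norm_sq,
      ← real_inner_self_eq_norm_sq, inner_kerVec_kerVec, inner_kerVec_kerVec, inner_kerVec_kerVec]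
  simp only [hnorm]
  refine Continuous.tendsto' ?_ y 0 (Real.sqrt_eq_zero'.2 (by linarith))
  exact (((hK.comp (by fun_prop : Continuous fun x : X => (x, x))).sub
    ((hK.comp (by fun_prop : Continuous fun x : X => (x, y))).const_mul 2)).add
    continuous_const).sqrt

lemma continuous_of_continuous_rkhsKernel [TopologicalSpace X]
    (hK : Continuous fun y : X × X => rkhsKernel H y.1 y.2) (v : H) : Continuous (v : X → ℝ) :=
  ((continuous_kerVec hK).inner continuous_const).congr fun x => inner_kerVec x v

variable (H) in
/-- The closed span of the representers of the evaluations at the points of `S`. Its orthogonal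
complement consists of the functions that vanish on `S`, so that the orthogonal projection onto it
maps `f` to the interpolant of `f` on `S` of minimal norm. -/
noncomputable def kerSpan (S : Set X) : Submodule ℝ H :=
  (Submodule.span ℝ (kerVec H '' S)).topologicalClosure

instance (S : Set X) : (kerSpan H S).HasOrthogonalProjection :=
  inferInstanceAs (Submodule.topologicalClosure _).HasOrthogonalProjection

lemma kerVec_mem_kerSpan {S : Set X} {s : X} (hs : s ∈ S) : kerVec H s ∈ kerSpan H S :=
  Submodule.le_topologicalClosure _ (Submodule.subset_span ⟨s, hs, rfl⟩)

lemma kerSpan_mono {S T : Set X} (h : S ⊆ T) : kerSpan H S ≤ kerSpan H T :=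
  Submodule.topologicalClosure_mono (Submodule.span_mono (Set.image_mono h))

lemma mem_orthogonal_kerSpan {S : Set X} {f : H} : f ∈ (kerSpan H S)ᗮ ↔ ∀ s ∈ S, f s = 0 := by
  refine ⟨fun hf s hs => ?_, fun hf => ?_⟩
  · rw [← inner_kerVec]
    exact (Submodule.mem_orthogonal _ _).1 hf _ (kerVec_mem_kerSpan hs)
  · rw [kerSpan, Submodule.orthogonal_closure, Submodule.mem_orthogonal]
    intro u hu
    induction hu using Submodule.span_induction with
    | mem u hu =>
      obtain ⟨s, hs, rfl⟩ := hu
      rw [inner_kerVec, hf s hs]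
    | zero => exact inner_zero_left f
    | add u v _ _ hu hv => rw [inner_add_left, hu, hv, add_zero]
    | smul c u _ hu => rw [inner_smul_left, hu, mul_zero]

lemma kerSpan_univ : kerSpan H (Set.univ : Set X) = ⊤ := by
  rw [← Submodule.orthogonal_eq_bot_iff, Submodule.eq_bot_iff]
  exact fun f hf => RKHS.ext fun x => by
    rw [mem_orthogonal_kerSpan.1 hf x trivial, RKHS.coe_zero, Pi.zero_apply]

lemma starProjection_apply_of_kerVec_mem {V : Submodule ℝ H} [V.HasOrthogonalProjection] {s : X}
    (hs : kerVec H s ∈ V) (f : H) : V.starProjection f s = f s := by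
  rw [← inner_kerVec, ← Submodule.inner_starProjection_left_eq_right,
    Submodule.starProjection_eq_self_iff.2 hs, inner_kerVec]

lemma inner_starProjection_kerSpan_of_eqOn {S : Set X} {f g : H} (h : ∀ s ∈ S, f s = g s) :
    ⟪(kerSpan H S).starProjection g, f⟫ = ‖(kerSpan H S).starProjection g‖ ^ 2 := by
  have hproj : (kerSpan H S).starProjection f = (kerSpan H S).starProjection g := by
    rw [← sub_eq_zero, ← map_sub, Submodule.starProjection_apply_eq_zero_iff,
      mem_orthogonal_kerSpan]
    exact fun s hs => by rw [RKHS.coe_sub, Pi.sub_apply, h s hs, sub_self]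
  rw [← Submodule.starProjection_eq_self_iff.2 ((kerSpan H S).starProjection_apply_mem g),
    Submodule.inner_starProjection_left_eq_right, hproj, real_inner_self_eq_norm_sq,
    Submodule.starProjection_eq_self_iff.2 ((kerSpan H S).starProjection_apply_mem g)]

lemma exists_coe_eq_of_norm_linearCombination_le {f : X → ℝ} {C : ℝ}
    (hC : ∀ a : X →₀ ℝ, ‖Finsupp.linearCombination ℝ f a‖
      ≤ C * ‖Finsupp.linearCombination ℝ (kerVec H) a‖) : ∃ v : H, (v : X → ℝ) = f := by
  let κ : (X →₀ ℝ) →ₗ[ℝ] H := Finsupp.linearCombination ℝ (kerVec H)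
  let ℓ : (X →₀ ℝ) →ₗ[ℝ] ℝ := Finsupp.linearCombination ℝ f
  have hdense : DenseRange κ := by
    have hrange : (LinearMap.range κ).topologicalClosure = ⊤ := by
      rw [Finsupp.range_linearCombination, ← Set.image_univ]
      exact kerSpan_univ
    exact Submodule.dense_iff_topologicalClosure_eq_top.2 hrange
  refine ⟨(InnerProductSpace.toDual ℝ H).symm (ℓ.extendOfNorm κ), funext fun x => ?_⟩
  rw [← inner_kerVec, real_inner_comm, InnerProductSpace.toDual_symm_apply]
  simpa [κ, ℓ] using LinearMap.extendOfNorm_eq (f := ℓ) hdense ⟨C, hC⟩ (Finsupp.single x 1)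

lemma exists_coe_eq_inner_featureMap {F : Type*} [NormedAddCommGroup F] [InnerProductSpace ℝ F]
    {φ : X → F} (hφ : ∀ x y, ⟪φ x, φ y⟫ = rkhsKernel H x y) (b : F) :
    ∃ v : H, (v : X → ℝ) = fun x => ⟪b, φ x⟫ := by
  refine exists_coe_eq_of_norm_linearCombination_le (C := ‖b‖) fun a => ?_
  have hnorm : ‖Finsupp.linearCombination ℝ φ a‖
      = ‖Finsupp.linearCombination ℝ (kerVec H) a‖ := by
    rw [← sq_eq_sq₀ (norm_nonneg _) (norm_nonneg _), ← real_inner_self_eq_norm_sq,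
      ← real_inner_self_eq_norm_sq]
    simp only [Finsupp.linearCombination_apply, Finsupp.sum, sum_inner, inner_sum,
      inner_smul_left, inner_smul_right, hφ, inner_kerVec_kerVec]
  have hinner : Finsupp.linearCombination ℝ (fun x => ⟪b, φ x⟫) a
      = ⟪b, Finsupp.linearCombination ℝ φ a⟫ := by
    simp only [Finsupp.linearCombination_apply, Finsupp.sum, inner_sum, inner_smul_right,
      smul_eq_mul]
  rw [hinner, ← hnorm]
  exact norm_inner_le_norm _ _

end ReproducingKernel

section Mercer

variable {n : ℕ} {Ω : Set (E n)} {K : Ω → Ω → ℝ} {lam : ℕ → ℝ} {e : ℕ → Ω → ℝ}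

lemma IsMercerExpansion.summable_sq_div (hM : IsMercerExpansion K lam e) {c : ℕ → ℝ} {θ : ℝ}
    (hθ : 1 ≤ θ) (hc : Summable fun i => lam i ^ (-θ) * c i ^ 2) :
    Summable fun i => c i ^ 2 / lam i := by
  refine Summable.of_nonneg_of_le (fun i => div_nonneg (sq_nonneg _) (hM.nonneg i)) (fun i => ?_)
    (hc.mul_left (lam 0 ^ (θ - 1)))
  have hlam0 := hM.nonneg 0
  obtain h0 | hpos := (hM.nonneg i).eq_or_lt
  · rw [← h0, div_zero]
    positivity
  · calc c i ^ 2 / lam i = lam i ^ (θ - 1) * (lam i ^ (-θ) * c i ^ 2) := by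
          rw [← mul_assoc, ← Real.rpow_add hpos, show θ - 1 + -θ = -1 by ring,
            Real.rpow_neg_one, inv_mul_eq_div]
      _ ≤ lam 0 ^ (θ - 1) * (lam i ^ (-θ) * c i ^ 2) := by
          gcongr
          exact hM.antitone (Nat.zero_le i)

lemma IsMercerExpansion.exists_featureMap (hM : IsMercerExpansion K lam e) :
    ∃ φ : Ω → lp (fun _ : ℕ => ℝ) 2, (∀ x i, φ x i = √(lam i) * e i x) ∧
      ∀ x y, ⟪φ x, φ y⟫ = K x y := by
  have hsq : ∀ i, √(lam i) ^ 2 = lam i := fun i => Real.sq_sqrt (hM.nonneg i)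
  have hmem : ∀ x, Memℓp (fun i => √(lam i) * e i x) 2 := fun x => by
    refine memℓp_gen ((hM.hasSum x x).summable.congr fun i => ?_)
    rw [ENNReal.toReal_ofNat, Real.rpow_ofNat, Real.norm_eq_abs, sq_abs, mul_pow, hsq]
    ring
  refine ⟨fun x => ⟨_, hmem x⟩, fun _ _ => rfl, fun x y => ?_⟩
  refine (lp.hasSum_inner (𝕜 := ℝ) _ _).unique ((hM.hasSum x y).congr_fun fun i => ?_)
  change √(lam i) * e i y * (√(lam i) * e i x) = _
  linear_combination (e i x * e i y) * hsq i

theorem exists_coe_eq_of_mem_powerSpace {H : Type*} [NormedAddCommGroup H]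
    [InnerProductSpace ℝ H] [CompleteSpace H] [RKHS ℝ H Ω ℝ] {θ : ℝ} (hθ : 1 ≤ θ) {u : Ω → ℝ}
    (hu : u ∈ powerSpace (rkhsKernel H) θ) : ∃ v : H, (v : Ω → ℝ) = u := by
  obtain ⟨lam, e, hM, c, hc0, hc, hsum⟩ := hu
  obtain ⟨φ, hφ, hφK⟩ := hM.exists_featureMap
  have hb : Memℓp (fun i => c i / √(lam i)) 2 := by
    refine memℓp_gen ((hM.summable_sq_div hθ hc).congr fun i => ?_)
    rw [ENNReal.toReal_ofNat, Real.rpow_ofNat, Real.norm_eq_abs, sq_abs, div_pow,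
      Real.sq_sqrt (hM.nonneg i)]
  obtain ⟨v, hv⟩ := exists_coe_eq_inner_featureMap hφK ⟨_, hb⟩
  refine ⟨v, hv.trans (funext fun x => (lp.hasSum_inner (𝕜 := ℝ) _ _).unique
    ((hsum x).congr_fun fun i => ?_))⟩
  rw [hφ]
  change √(lam i) * e i x * (c i / √(lam i)) = _
  obtain h0 | h0 := eq_or_ne (lam i) 0
  · rw [hc0 i h0, zero_div, mul_zero, zero_mul]
  · have : √(lam i) ≠ 0 := (Real.sqrt_ne_zero (hM.nonneg i)).2 h0
    field_simp

end Mercer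

section Restriction

variable {n k k' : ℕ} {Ω Ω' : Set (E n)}

lemma IsTest.multiDeriv {φ : E n → ℝ} (hφ : IsTest Ω φ) (α : Fin n → ℕ) :
    IsTest Ω (multiDeriv α φ) := by
  obtain ⟨l, -, hl⟩ := exists_multiDeriv_eq_foldr α
  rw [hl]
  clear hl
  induction l with
  | nil => exact hφ
  | cons i l ih => exact ih.partialDeriv i

/-- The restriction to a subset of a square integrable function. -/
noncomputable def restrictL2 (hsub : Ω' ⊆ Ω) (f : Lp ℝ 2 (volume.restrict Ω)) :
    Lp ℝ 2 (volume.restrict Ω') :=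
  ((Lp.memLp f).mono_measure (Measure.restrict_mono hsub le_rfl)).toLp f

lemma restrictL2_ae_eq (hsub : Ω' ⊆ Ω) (f : Lp ℝ 2 (volume.restrict Ω)) :
    restrictL2 hsub f =ᵐ[volume.restrict Ω'] f :=
  MemLp.coeFn_toLp _

lemma norm_restrictL2_le (hsub : Ω' ⊆ Ω) (f : Lp ℝ 2 (volume.restrict Ω)) :
    ‖restrictL2 hsub f‖ ≤ ‖f‖ := by
  rw [restrictL2, Lp.norm_toLp, Lp.norm_def]
  exact ENNReal.toReal_mono (Lp.eLpNorm_ne_top _)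
    (eLpNorm_mono_measure _ (Measure.restrict_mono hsub le_rfl))

lemma IsTest.integral_restrictL2_mul {ψ : E n → ℝ} (hψ : IsTest Ω' ψ) (hΩ : MeasurableSet Ω)
    (hsub : Ω' ⊆ Ω) (f : Lp ℝ 2 (volume.restrict Ω)) :
    ∫ x in Ω', restrictL2 hsub f x * ψ x = ∫ x in Ω, f x * ψ x := by
  rw [setIntegral_eq_of_subset_of_forall_sdiff_eq_zero hΩ hsub
    fun x hx => by rw [hψ.eq_zero hx.2, mul_zero]]
  refine integral_congr_ae ?_
  filter_upwards [restrictL2_ae_eq hsub f] with x hx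
  rw [hx]

lemma multiIdx_mono (hk : k' ≤ k) : multiIdx n k' ⊆ multiIdx n k := fun _ hα =>
  mem_multiIdx.2 ((mem_multiIdx.1 hα).trans hk)

/-- The restriction `H^k(Ω) → H^{k'}(Ω')`, for `Ω' ⊆ Ω` and `k' ≤ k`. -/
noncomputable def restrictSobolev (hk : k' ≤ k) (hΩ : MeasurableSet Ω) (hsub : Ω' ⊆ Ω)
    (w : SobolevSpace k Ω) : SobolevSpace k' Ω' :=
  ⟨WithLp.toLp 2 fun α => restrictL2 hsub (w.1 ⟨α.1, multiIdx_mono hk α.2⟩), fun α φ hφ => by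
    refine ((hφ.multiDeriv α.1).integral_restrictL2_mul hΩ hsub _).trans ?_
    rw [hφ.integral_restrictL2_mul hΩ hsub]
    exact w.2 ⟨α.1, multiIdx_mono hk α.2⟩ φ (hφ.mono hsub)⟩

lemma norm_restrictSobolev_le (hk : k' ≤ k) (hΩ : MeasurableSet Ω) (hsub : Ω' ⊆ Ω)
    (w : SobolevSpace k Ω) : ‖restrictSobolev hk hΩ hsub w‖ ≤ ‖w‖ := by
  refine (sq_le_sq₀ (norm_nonneg _) (norm_nonneg _)).1 ?_
  rw [Submodule.coe_norm, Submodule.coe_norm, PiLp.norm_sq_eq_of_L2, PiLp.norm_sq_eq_of_L2]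
  let j : multiIdx n k' ↪ multiIdx n k :=
    ⟨Set.inclusion (multiIdx_mono hk), Set.inclusion_injective _⟩
  calc ∑ α, ‖(restrictSobolev hk hΩ hsub w).1 α‖ ^ 2 ≤ ∑ α, ‖w.1 (j α)‖ ^ 2 :=
        Finset.sum_le_sum fun α _ =>
          pow_le_pow_left₀ (norm_nonneg _) (norm_restrictL2_le hsub (w.1 (j α))) 2
    _ = ∑ β ∈ Finset.univ.map j, ‖w.1 β‖ ^ 2 :=
        (Finset.sum_map Finset.univ j fun β => ‖w.1 β‖ ^ 2).symm
    _ ≤ ∑ β, ‖w.1 β‖ ^ 2 := Finset.sum_le_univ_sum_of_nonneg fun _ => sq_nonneg _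

lemma Represents.restrictSobolev {w : SobolevSpace k Ω} {f : E n → ℝ} (h : Represents w f)
    (hk : k' ≤ k) (hΩ : MeasurableSet Ω) (hsub : Ω' ⊆ Ω) :
    Represents (restrictSobolev hk hΩ hsub w) f :=
  (restrictL2_ae_eq hsub _).trans (ae_mono (Measure.restrict_mono hsub le_rfl) h)

lemma Represents.sobolevENorm_le {w : SobolevSpace k Ω} {f : E n → ℝ} (h : Represents w f)
    (hk : k' ≤ k) (hΩ : MeasurableSet Ω) (hsub : Ω' ⊆ Ω) : sobolevENorm k' Ω' f ≤ ‖w‖ₑ :=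
  (iInf₂_le (KEqL.restrictSobolev hk hΩ hsub w) (h.restrictSobolev hk hΩ hsub)).trans
    (enorm_le_iff_norm_le.2 (norm_restrictSobolev_le hk hΩ hsub w))

lemma Represents.sub {w w' : SobolevSpace k Ω} {f g : E n → ℝ} (h : Represents w f)
    (h' : Represents w' g) : Represents (w - w') (fun x => f x - g x) := by
  refine (Lp.coeFn_sub (w.1 (zeroIdx n k)) (w'.1 (zeroIdx n k))).trans ?_
  filter_upwards [h, h'] with x hx hx'
  rw [Pi.sub_apply, hx, hx']

lemma sobolevENorm_congr_ae {f g : E n → ℝ} (h : f =ᵐ[volume.restrict Ω] g) :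
    sobolevENorm k Ω f = sobolevENorm k Ω g :=
  iInf_congr fun _ => iInf_congr_Prop ⟨fun h' => h'.trans h, fun h' => h'.trans h.symm⟩ fun _ => rfl

end Restriction

section Embedding

variable {n k : ℕ} {Ω : Set (E n)} {V : Type*} [NormedAddCommGroup V] [NormedSpace ℝ V]
  {F : V → E n → ℝ}

/-- A normed space `V`, whose elements `v` are regarded as the functions `F v`, is continuously
embedded in `H^k(Ω)`: `v ↦ F v` is a bounded linear map `V → H^k(Ω)`. -/
def ContinuouslyEmbedded (F : V → E n → ℝ) (k : ℕ) (Ω : Set (E n)) : Prop :=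
  ∃ ι : V →L[ℝ] SobolevSpace k Ω, ∀ v, Represents (ι v) (F v)

lemma CompactlyEmbedded.continuouslyEmbedded (h : CompactlyEmbedded F k Ω) :
    ContinuouslyEmbedded F k Ω :=
  let ⟨ι, _, hι⟩ := h
  ⟨ι, hι⟩

lemma ContinuouslyEmbedded.memSobolev (h : ContinuouslyEmbedded F k Ω) (v : V) :
    MemSobolev k Ω (F v) :=
  let ⟨ι, hι⟩ := h
  ⟨ι v, hι v⟩

lemma ContinuouslyEmbedded.tendsto_sobolevENorm (h : ContinuouslyEmbedded F k Ω) {k' : ℕ}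
    (hk : k' ≤ k) (hΩ : MeasurableSet Ω) {Ω' : Set (E n)} (hsub : Ω' ⊆ Ω) {ι : Type*}
    {l : Filter ι} {v : ι → V} {a : V} (hv : Tendsto v l (𝓝 a)) :
    Tendsto (fun i => sobolevENorm k' Ω' fun x => F (v i) x - F a x) l (𝓝 0) := by
  obtain ⟨T, hT⟩ := h
  have hlim : Tendsto (fun i => ‖T (v i) - T a‖ₑ) l (𝓝 0) := by
    have hsub := ((T.continuous.tendsto a).comp hv).sub_const (T a)
    rw [sub_self] at hsub
    exact (continuous_enorm.tendsto' 0 0 enorm_zero).comp hsub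
  exact tendsto_of_tendsto_of_tendsto_of_le_of_le tendsto_const_nhds hlim (fun _ => zero_le)
    fun i => ((hT (v i)).sub (hT a)).sobolevENorm_le hk hΩ hsub

end Embedding

section FillDistance

variable {n : ℕ} {ι : Type*} {l : Filter ι}

lemma infEDist_le_fillDistance {A : Set (E n)} {y : E n} (hy : y ∈ A) (X : Set (E n)) :
    Metric.infEDist y X ≤ fillDistance A X :=
  le_iSup₂ (f := fun y (_ : y ∈ A) => Metric.infEDist y X) y hy

lemma subset_closure_of_tendsto_fillDistance [NeBot l] {A Z : Set (E n)} {X : ι → Set (E n)}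
    (h : Tendsto (fun i => fillDistance A (X i)) l (𝓝 0)) (hX : ∀ i, X i ⊆ Z) :
    A ⊆ closure Z := fun y hy => by
  rw [Metric.mem_closure_iff_infEDist_zero, ← nonpos_iff_eq_zero]
  exact ge_of_tendsto h <| Eventually.of_forall fun i =>
    (Metric.infEDist_anti (hX i)).trans (infEDist_le_fillDistance hy (X i))

lemma exists_tendsto_of_tendsto_fillDistance {Ω : Set (E n)} {Y : ι → Finset Ω}
    (h : Tendsto (fun i => fillDistance Ω (Subtype.val '' (Y i : Set Ω))) l (𝓝 0)) (y : Ω) :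
    ∃ z : ι → Ω, Tendsto z l (𝓝 y) ∧ ∀ᶠ i in l, z i ∈ Y i := by
  have hdist : Tendsto (fun i => Metric.infEDist (y : E n) (Subtype.val '' (Y i : Set Ω))) l
      (𝓝 0) :=
    tendsto_of_tendsto_of_tendsto_of_le_of_le tendsto_const_nhds h (fun _ => zero_le)
      fun i => infEDist_le_fillDistance y.2 _
  have hne : ∀ᶠ i in l, (Y i).Nonempty := by
    filter_upwards [hdist (gt_mem_nhds (zero_lt_one' ℝ≥0∞))] with i hi
    by_contra hemp
    simp [Finset.not_nonempty_iff_eq_empty.1 hemp] at hi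
  have hnearest : ∀ i, ∃ z : Ω, (Y i).Nonempty → z ∈ Y i ∧
      Metric.infEDist (y : E n) (Subtype.val '' (Y i : Set Ω)) = edist y z := fun i => by
    by_cases hi : (Y i).Nonempty
    · obtain ⟨-, ⟨z, hz, rfl⟩, hyz⟩ := ((Y i).finite_toSet.image Subtype.val).isCompact
        |>.exists_infEDist_eq_edist (hi.to_set.image _) (y : E n)
      exact ⟨z, fun _ => ⟨hz, hyz⟩⟩
    · exact ⟨y, fun h => absurd h hi⟩
  choose z hz using hnearest
  refine ⟨z, ?_, hne.mono fun i hi => (hz i hi).1⟩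
  rw [tendsto_iff_edist_tendsto_0]
  exact hdist.congr' (hne.mono fun i hi => (hz i hi).2.trans (edist_comm _ _))

end FillDistance

section JetsAlongWeakLimits

variable {n p : ℕ} {Ω : Set (E n)} {H : Type*} [NormedAddCommGroup H] [InnerProductSpace ℝ H]
  {F : H → E n → ℝ} {ι : Type*} {l : Filter ι} {x : ι → H} {a : H} {R : ℝ} {y : ι → Ω} {y₀ : Ω}

lemma HasContinuousJets.tendsto_multiDeriv (hF : HasContinuousJets F p Ω) {α : Fin n → ℕ}
    (hα : α ∈ multiIdx n p) (hx : WeakTendsto x l a) (hR : ∀ i, ‖x i‖ ≤ R)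
    (hy : Tendsto y l (𝓝 y₀)) :
    Tendsto (fun i => multiDeriv α (F (x i)) (y i)) l (𝓝 (multiDeriv α (F a) y₀)) := by
  obtain ⟨κ, hκ, hκF⟩ := hF α hα
  simpa only [hκF, Function.comp_apply] using hx.tendsto_inner hR ((hκ.tendsto y₀).comp hy)

lemma HasContinuousJets.tendsto_apply (hF : HasContinuousJets F p Ω) (hx : WeakTendsto x l a)
    (hR : ∀ i, ‖x i‖ ≤ R) (hy : Tendsto y l (𝓝 y₀)) :
    Tendsto (fun i => F (x i) (y i)) l (𝓝 (F a y₀)) := by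
  simpa [multiDeriv, zeroIdx] using hF.tendsto_multiDeriv (zeroIdx n p).2 hx hR hy

lemma HasContinuousJets.tendsto_apply_of_univ (hF : HasContinuousJets F p Set.univ)
    (hx : WeakTendsto x l a) (hR : ∀ i, ‖x i‖ ≤ R) {y : ι → E n} {y₀ : E n}
    (hy : Tendsto y l (𝓝 y₀)) : Tendsto (fun i => F (x i) (y i)) l (𝓝 (F a y₀)) :=
  hF.tendsto_apply (y := fun i => ⟨y i, Set.mem_univ _⟩) (y₀ := ⟨y₀, Set.mem_univ _⟩) hx hR
    (tendsto_subtype_rng.2 hy)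

end JetsAlongWeakLimits

section FunctionsOnDomain

variable {n p : ℕ} {Ω : Set (E n)} {H : Type*} [NormedAddCommGroup H] [InnerProductSpace ℝ H]
  [RKHS ℝ H Ω ℝ] {ι : Type*} {l : Filter ι}

lemma ext0_apply (v : Ω → ℝ) (y : Ω) : ext0 v y = v y :=
  Subtype.val_injective.extend_apply v 0 y

lemma continuousOn_ext0 {v : Ω → ℝ} (hv : Continuous v) : ContinuousOn (ext0 v) Ω := by
  rw [continuousOn_iff_continuous_domRestrict]
  exact hv.congr fun y => (ext0_apply v y).symm

lemma ext0_sub (v w : Ω → ℝ) : ext0 (fun y => v y - w y) = fun x => ext0 v x - ext0 w x := by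
  funext x
  by_cases hx : ∃ y : Ω, (y : E n) = x
  · obtain ⟨y, rfl⟩ := hx
    simp only [ext0_apply]
  · simp [ext0, Function.extend_apply' _ _ _ hx]

lemma hasPointEvaluations_ext0 [CompleteSpace H] :
    HasPointEvaluations (fun v : H => ext0 (v : Ω → ℝ)) Ω := fun x hx =>
  ⟨kerVec H ⟨x, hx⟩, fun v => (inner_kerVec _ v).trans (ext0_apply v ⟨x, hx⟩).symm⟩

lemma HasContinuousJets.tendsto_Phi {Q : ℕ}
    (hH : HasContinuousJets (fun v : H => ext0 (v : Ω → ℝ)) p Ω) (L : Fin Q → DiffOp Ω p)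
    {x : ι → H} {a : H} {R : ℝ} (hx : WeakTendsto x l a) (hR : ∀ i, ‖x i‖ ≤ R) {y : ι → Ω}
    {y₀ : Ω} (hy : Tendsto y l (𝓝 y₀)) :
    Tendsto (fun i => Phi L (x i) (y i)) l (𝓝 (Phi L a y₀)) := by
  refine ((PiLp.continuous_toLp 2 _).tendsto _).comp (tendsto_pi_nhds.2 fun c => ?_)
  refine Fin.addCases (fun j => ?_) (fun q => ?_) c
  · simp only [Fin.append_left]
    exact ((by fun_prop : Continuous fun y : Ω => (y : E n) j).tendsto y₀).comp hy
  · simp only [Fin.append_right, DiffOp.eval]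
    exact tendsto_finsetSum _ fun α _ => ((((L q).continuous_coeff α).tendsto y₀).comp hy).mul
      (hH.tendsto_multiDeriv α.2 hx hR hy)

lemma HasContinuousJets.eq_of_weakTendsto_interpolant [NeBot l]
    (hH : HasContinuousJets (fun v : H => ext0 (v : Ω → ℝ)) p Ω) {Y : ι → Finset Ω}
    (hY : Tendsto (fun i => fillDistance Ω (Subtype.val '' (Y i : Set Ω))) l (𝓝 0))
    {x : ι → H} {a c : H} {R : ℝ} (hx : ∀ i, ∀ y ∈ Y i, x i y = a y) (hR : ∀ i, ‖x i‖ ≤ R)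
    (hc : WeakTendsto x l c) : c = a := RKHS.ext fun y => by
  obtain ⟨z, hz, hzY⟩ := exists_tendsto_of_tendsto_fillDistance hY y
  have hlim_c : Tendsto (fun i => x i (z i)) l (𝓝 (c y)) := by
    simpa only [ext0_apply] using hH.tendsto_apply hc hR hz
  have hlim_a : Tendsto (fun i => a (z i)) l (𝓝 (a y)) := by
    simpa only [ext0_apply] using hH.tendsto_apply (weakTendsto_const a l) (fun _ => le_rfl) hz
  exact tendsto_nhds_unique hlim_c (hlim_a.congr' (hzY.mono fun i hi => (hx i _ hi).symm))

end FunctionsOnDomain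

section HilbertSum

variable {H G κ : Type*} [NormedAddCommGroup H] [NormedAddCommGroup G]

/-- The pair `((v^m), G)` as an element of the Hilbert sum `(⨁_m 𝓤) ⊕ 𝓟`, in which the objective
of the learning problem is the squared norm. -/
noncomputable def toL2 (z : (κ → H) × G) : WithLp 2 (PiLp 2 (fun _ : κ => H) × G) :=
  WithLp.toLp 2 (WithLp.toLp 2 z.1, z.2)

lemma tendsto_fst_apply_of_tendsto_toL2 {ι : Type*} {l : Filter ι} {z : ι → (κ → H) × G}
    {w : (κ → H) × G} (h : Tendsto (fun i => toL2 (z i)) l (𝓝 (toL2 w))) (m : κ) :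
    Tendsto (fun i => (z i).1 m) l (𝓝 (w.1 m)) :=
  ((by fun_prop : Continuous fun x : WithLp 2 (PiLp 2 (fun _ : κ => H) × G) =>
    x.fst m).tendsto _).comp h

lemma tendsto_snd_of_tendsto_toL2 {ι : Type*} {l : Filter ι} {z : ι → (κ → H) × G}
    {w : (κ → H) × G} (h : Tendsto (fun i => toL2 (z i)) l (𝓝 (toL2 w))) :
    Tendsto (fun i => (z i).2) l (𝓝 w.2) :=
  ((by fun_prop : Continuous fun x : WithLp 2 (PiLp 2 (fun _ : κ => H) × G) =>
    x.snd).tendsto (toL2 w)).comp (f := fun i => toL2 (z i)) h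

variable [Fintype κ]

lemma norm_toL2_sq (z : (κ → H) × G) : ‖toL2 z‖ ^ 2 = ‖z.2‖ ^ 2 + ∑ m, ‖z.1 m‖ ^ 2 := by
  rw [WithLp.prod_norm_sq_eq_of_L2, PiLp.norm_sq_eq_of_L2, add_comm]
  rfl

lemma norm_fst_apply_le_norm_toL2 (z : (κ → H) × G) (m : κ) : ‖z.1 m‖ ≤ ‖toL2 z‖ :=
  (PiLp.norm_apply_le (toL2 z).fst m).trans (WithLp.norm_fst_le _ _)

lemma norm_snd_le_norm_toL2 (z : (κ → H) × G) : ‖z.2‖ ≤ ‖toL2 z‖ :=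
  WithLp.norm_snd_le _ (toL2 z)

end HilbertSum

section Minimizers

variable {d Q p M : ℕ} {𝓨 : Set (E d)} {HU HP : Type*}
  [NormedAddCommGroup HU] [InnerProductSpace ℝ HU] [RKHS ℝ HU 𝓨 ℝ]
  [NormedAddCommGroup HP] [InnerProductSpace ℝ HP] [RKHS ℝ HP (E (d + Q)) ℝ]
  {L : Fin Q → DiffOp 𝓨 p} {Pbar : E (d + Q) → ℝ} {u f : ℕ → 𝓨 → ℝ} {Y : ℕ → ℕ → Finset 𝓨}

/-- The union of the graphs `Φ(u^m, 𝓨)`, `m < M`: the part of `𝓢` on which the first `M` training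
pairs determine the equation. -/
def graphPoints (L : Fin Q → DiffOp 𝓨 p) (u : ℕ → 𝓨 → ℝ) (M : ℕ) : Set (E (d + Q)) :=
  ⋃ m < M, Set.range (Phi L (u m))

lemma Phi_mem_graphPoints {m : ℕ} (hm : m < M) (y : 𝓨) : Phi L (u m) y ∈ graphPoints L u M :=
  Set.mem_biUnion (show m ∈ {m | m < M} from hm) ⟨y, rfl⟩

lemma graphPoints_mono (L : Fin Q → DiffOp 𝓨 p) (u : ℕ → 𝓨 → ℝ) : Monotone (graphPoints L u) :=
  fun _ _ hM => Set.biUnion_subset_biUnion_left fun _ hm => lt_of_lt_of_le hm hM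

lemma dataPoints_subset_graphPoints (M N : ℕ) : dataPoints L u Y M N ⊆ graphPoints L u M :=
  Set.iUnion₂_mono fun _ _ => Set.image_subset_range _ _

lemma IsMinimizer.norm_toL2_le {N : ℕ} {z w : (Fin M → HU) × HP}
    (hz : IsMinimizer HU HP L Pbar u f Y M N z) (hw : w ∈ feasible HU HP L Pbar u f Y M N) :
    ‖toL2 z‖ ≤ ‖toL2 w‖ := by
  rw [← sq_le_sq₀ (norm_nonneg _) (norm_nonneg _), norm_toL2_sq, norm_toL2_sq]
  exact isMinOn_iff.1 hz.2 w hw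

variable {P : HP} {a : Fin M → HU}

lemma mem_feasible_of_eqOn_graphPoints
    (hpde : ∀ m y, Pbar (Phi L (u m) y) + P (Phi L (u m) y) = f m y)
    (ha : ∀ m : Fin M, (a m : 𝓨 → ℝ) = u m) {G : HP}
    (hG : ∀ s ∈ graphPoints L u M, G s = P s) (N : ℕ) :
    (a, G) ∈ feasible HU HP L Pbar u f Y M N := by
  refine ⟨fun m y _ => congrFun (ha m) y, fun m y _ => ?_⟩
  simp only [ha m]
  rw [hG _ (Phi_mem_graphPoints m.2 y), ← hpde, add_sub_cancel_left]

variable {l : Filter ℕ}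

/-- The collocation constraint is imposed along the curve of the approximate state `(z N).1 m`, not
along that of `u m`; it survives the limit because `Φ` is continuous for weak convergence of the
state, uniformly at moving points. -/
lemma eqOn_graphPoints_of_weakTendsto [NeBot l]
    (hU : HasContinuousJets (fun v : HU => ext0 (v : 𝓨 → ℝ)) p 𝓨)
    (hP : HasContinuousJets (fun G : HP => (G : E (d + Q) → ℝ)) 0 Set.univ)
    (hPbar : Continuous Pbar)
    (hpde : ∀ m y, Pbar (Phi L (u m) y) + P (Phi L (u m) y) = f m y)
    (hρ : ∀ m, Tendsto (fun N => fillDistance 𝓨 (Subtype.val '' (Y m N : Set 𝓨))) l (𝓝 0))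
    (ha : ∀ m : Fin M, (a m : 𝓨 → ℝ) = u m) {z : ℕ → (Fin M → HU) × HP}
    (hz : ∀ N, z N ∈ feasible HU HP L Pbar u f Y M N) {R : ℝ} (hR : ∀ N, ‖toL2 (z N)‖ ≤ R)
    (hstate : ∀ m, WeakTendsto (fun N => (z N).1 m) l (a m)) {c : HP}
    (hc : WeakTendsto (fun N => (z N).2) l c) {s : E (d + Q)} (hs : s ∈ graphPoints L u M) :
    c s = P s := by
  simp only [graphPoints, Set.mem_iUnion, Set.mem_range] at hs
  obtain ⟨m, hm, y, rfl⟩ := hs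
  obtain ⟨t, ht, htY⟩ := exists_tendsto_of_tendsto_fillDistance (hρ m) y
  have hPhi_a := hU.tendsto_Phi L (weakTendsto_const (a ⟨m, hm⟩) l) (fun _ => le_rfl) ht
  have hPhi_z := hU.tendsto_Phi L (hstate ⟨m, hm⟩)
    (fun N => (norm_fst_apply_le_norm_toL2 (z N) _).trans (hR N)) ht
  rw [ha] at hPhi_a hPhi_z
  have hlim_G : Tendsto (fun N => (z N).2 (Phi L ((z N).1 ⟨m, hm⟩) (t N))) l
      (𝓝 (c (Phi L (u m) y))) :=
    hP.tendsto_apply_of_univ hc (fun N => (norm_snd_le_norm_toL2 _).trans (hR N)) hPhi_z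
  have hlim_P : Tendsto (fun N => P (Phi L (u m) (t N))) l (𝓝 (P (Phi L (u m) y))) :=
    hP.tendsto_apply_of_univ (weakTendsto_const P l) (fun _ => le_rfl) hPhi_a
  have hlim_f : Tendsto (fun N => f m (t N) - Pbar (Phi L ((z N).1 ⟨m, hm⟩) (t N))) l
      (𝓝 (P (Phi L (u m) y))) := by
    have := (((hPbar.tendsto _).comp hPhi_a).add hlim_P).sub ((hPbar.tendsto _).comp hPhi_z)
    rw [add_sub_cancel_left] at this
    exact this.congr fun N => by simp only [Function.comp_apply, hpde]
  refine tendsto_nhds_unique hlim_G (hlim_f.congr' (htY.mono fun N hN => ?_))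
  exact ((hz N).2 ⟨m, hm⟩ (t N) (Set.mem_biUnion (show m ∈ {m | m < M} from hm) hN)).symm

lemma tendsto_toL2_minimizer [CompleteSpace HU] [CompleteSpace HP]
    (hU : HasContinuousJets (fun v : HU => ext0 (v : 𝓨 → ℝ)) p 𝓨)
    (hP : HasContinuousJets (fun G : HP => (G : E (d + Q) → ℝ)) 0 Set.univ)
    (hPbar : Continuous Pbar)
    (hpde : ∀ m y, Pbar (Phi L (u m) y) + P (Phi L (u m) y) = f m y)
    (hρ : ∀ m, Tendsto (fun N => fillDistance 𝓨 (Subtype.val '' (Y m N : Set 𝓨))) l (𝓝 0))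
    (ha : ∀ m : Fin M, (a m : 𝓨 → ℝ) = u m) {z : ℕ → (Fin M → HU) × HP}
    (hz : ∀ N, IsMinimizer HU HP L Pbar u f Y M N (z N)) :
    Tendsto (fun N => toL2 (z N)) l
      (𝓝 (toL2 (a, (kerSpan HP (graphPoints L u M)).starProjection P))) := by
  have hbound N : ‖toL2 (z N)‖ ≤ ‖toL2 (a, (kerSpan HP (graphPoints L u M)).starProjection P)‖ :=
    (hz N).norm_toL2_le <| mem_feasible_of_eqOn_graphPoints hpde ha
      (fun s hs => starProjection_apply_of_kerVec_mem (kerVec_mem_kerSpan hs) P) N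
  refine tendsto_of_norm_le_of_weakTendsto hbound fun 𝒰 h𝒰 c hc => ?_
  have hρ𝒰 m := (hρ m).mono_left h𝒰
  have hc_fst (m : Fin M) : WeakTendsto (fun N => (z N).1 m) 𝒰 (c.fst m) :=
    hc.map ((PiLp.proj 2 _ m).comp (WithLp.fstL 2 ℝ _ _))
  have hc_state (m : Fin M) : c.fst m = a m :=
    hU.eq_of_weakTendsto_interpolant (hρ𝒰 m)
      (fun N y hy => ((hz N).1.1 m y hy).trans (congrFun (ha m) y).symm)
      (fun N => (norm_fst_apply_le_norm_toL2 (z N) m).trans (hbound N)) (hc_fst m)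
  have hc_eqn : ∀ s ∈ graphPoints L u M, c.snd s = P s := fun s hs =>
    eqOn_graphPoints_of_weakTendsto hU hP hPbar hpde hρ𝒰 ha (fun N => (hz N).1) hbound
      (fun m => hc_state m ▸ hc_fst m) (hc.map (WithLp.sndL 2 ℝ _ _)) hs
  rw [WithLp.prod_inner_apply, PiLp.inner_apply, norm_toL2_sq, add_comm]
  congr 1
  · exact inner_starProjection_kerSpan_of_eqOn hc_eqn
  · exact Finset.sum_congr rfl fun m _ => by
      rw [← real_inner_self_eq_norm_sq]; exact congrArg _ (hc_state m)

end Minimizers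

section ManyPairs

lemma exists_tendsto_starProjection_kerSpan {X H ι : Type*} [NormedAddCommGroup H]
    [InnerProductSpace ℝ H] [CompleteSpace H] [RKHS ℝ H X ℝ] [Preorder ι] {S : ι → Set X}
    (hS : Monotone S) (g : H) :
    ∃ G : H, Tendsto (fun i => (kerSpan H (S i)).starProjection g) atTop (𝓝 G) ∧
      ∀ i, ∀ s ∈ S i, G s = g s :=
  ⟨_, Submodule.starProjection_tendsto_closure_iSup _ (fun _ _ h => kerSpan_mono (hS h)) g,
    fun i _ hs => starProjection_apply_of_kerVec_mem (Submodule.le_topologicalClosure _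
      (Submodule.mem_iSup_of_mem i (kerVec_mem_kerSpan hs))) g⟩

variable {d Q p : ℕ} {𝓨 : Set (E d)} {L : Fin Q → DiffOp 𝓨 p} {u : ℕ → 𝓨 → ℝ}
  {Y : ℕ → ℕ → Finset 𝓨} {B : Set (E (d + Q))}

lemma eqOn_of_eqOn_graphPoints
    (hϱ : Tendsto (fun q : ℕ × ℕ => fillDistance B (dataPoints L u Y q.1 q.2 ∩ B)) atTop (𝓝 0))
    {F G : E (d + Q) → ℝ} (hF : Continuous F) (hG : Continuous G)
    (h : ∀ M, Set.EqOn F G (graphPoints L u M)) : Set.EqOn F G B := fun _ hs =>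
  (isClosed_eq hF hG).closure_subset <| subset_closure_of_tendsto_fillDistance hϱ
    (fun q _ hq => h q.1 (dataPoints_subset_graphPoints q.1 q.2 hq.1)) hs

lemma ae_restrict_eq_of_eqOn {n : ℕ} {A : Set (E n)} {F G : E n → ℝ} (hF : Continuous F)
    (hG : Continuous G) (h : Set.EqOn F G A) : F =ᵐ[volume.restrict A] G :=
  ae_restrict_of_ae_restrict_of_subset (t := {s | F s = G s}) h
    (ae_restrict_mem (isClosed_eq hF hG).measurableSet)

end ManyPairs

end KEqL

theorem mainTheorem5_general
    {d Q p : ℕ} {𝓨 : Set (E d)} (h𝓨_open : IsOpen 𝓨)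
    {HU HP : Type*}
    [NormedAddCommGroup HU] [InnerProductSpace ℝ HU] [CompleteSpace HU] [RKHS ℝ HU 𝓨 ℝ]
    [NormedAddCommGroup HP] [InnerProductSpace ℝ HP] [CompleteSpace HP]
    [RKHS ℝ HP (E (d + Q)) ℝ]
    (L : Fin Q → DiffOp 𝓨 p) (Pbar : E (d + Q) → ℝ) (hPbar : Continuous Pbar)
    (hU_cont : ∀ v : HU, Continuous (v : 𝓨 → ℝ)) (γ : ℕ) (hγ : (d : ℝ) / 2 + p < γ)
    (hU_emb : ContinuouslyEmbedded (fun v : HU => ext0 (v : 𝓨 → ℝ)) γ 𝓨)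
    (η : ℕ) (hη : ((Q : ℝ) + d) / 2 < η) (hP_cont : ∀ G : HP, Continuous (G : E (d + Q) → ℝ))
    (hP_emb : ContinuouslyEmbedded (fun G : HP => (G : E (d + Q) → ℝ)) η Set.univ)
    (P : HP) (u f : ℕ → 𝓨 → ℝ)
    (hpde : ∀ m y, Pbar (Phi L (u m) y) + P (Phi L (u m) y) = f m y)
    (Y : ℕ → ℕ → Finset 𝓨) (B : Set (E (d + Q)))
    (hρ : ∀ m, Tendsto (fun N => fillDistance 𝓨 (Subtype.val '' (Y m N : Set 𝓨))) atTop (𝓝 0))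
    (hϱ : Tendsto (fun q : ℕ × ℕ => fillDistance B (dataPoints L u Y q.1 q.2 ∩ B)) atTop (𝓝 0)) :
    (∀ (M : ℕ) (uhat : ℕ → Fin M → HU) (Phat : ℕ → HP),
      (∀ N, IsMinimizer HU HP L Pbar u f Y M N (uhat N, Phat N)) →
      (∀ m : Fin M, ∃ v : HU, (v : 𝓨 → ℝ) = u m) →
      ∀ m : Fin M,
        (∀ y : 𝓨, Tendsto (fun N => uhat N m y) atTop (𝓝 (u m y))) ∧
        ∀ γ' : ℕ, γ' ≤ γ →
          Tendsto (fun N => sobolevENorm γ' 𝓨 (ext0 fun y => uhat N m y - u m y)) atTop (𝓝 0)) ∧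
    (∀ (uhat : ∀ M : ℕ, ℕ → Fin M → HU) (Phat : ℕ → ℕ → HP),
      (∀ M N, IsMinimizer HU HP L Pbar u f Y M N (uhat M N, Phat M N)) →
      (∀ m, ∃ v : HU, (v : 𝓨 → ℝ) = u m) →
      ∃ Plim : ℕ → E (d + Q) → ℝ,
        ((∀ M, ∀ s ∈ B, Tendsto (fun N => Phat M N s) atTop (𝓝 (Plim M s))) ∧
          ∀ s ∈ B, Tendsto (fun M => Plim M s) atTop (𝓝 (P s))) ∧
        ∀ η' : ℕ, η' ≤ η →
          (∀ M, Tendsto (fun N => sobolevENorm η' B fun s => Phat M N s - Plim M s)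
            atTop (𝓝 0)) ∧
          Tendsto (fun M => sobolevENorm η' B fun s => Plim M s - P s) atTop (𝓝 0)) := by
  have hU : HasContinuousJets (fun v : HU => ext0 (v : 𝓨 → ℝ)) p 𝓨 :=
    hasPointEvaluations_ext0.hasContinuousJets_of_memSobolev h𝓨_open
      (fun v => continuousOn_ext0 (hU_cont v)) hγ hU_emb.memSobolev
  have hP : HasContinuousJets (fun G : HP => (G : E (d + Q) → ℝ)) 0 Set.univ :=
    HasPointEvaluations.hasContinuousJets_of_memSobolev
      (fun s _ => ⟨kerVec HP s, inner_kerVec s⟩) isOpen_univ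
      (fun G => (hP_cont G).continuousOn) (by push_cast; linarith) hP_emb.memSobolev
  refine ⟨fun M uhat Phat hmin hu m => ?_, fun uhat Phat hmin hu => ?_⟩ <;> choose a ha using hu
  · have hlim : Tendsto (fun N => uhat N m) atTop (𝓝 (a m)) :=
      tendsto_fst_apply_of_tendsto_toL2 (tendsto_toL2_minimizer hU hP hPbar hpde hρ ha hmin) m
    simp only [← ha m, ext0_sub]
    exact ⟨fun y => ((RKHS.continuous_eval y).tendsto _).comp hlim, fun γ' hγ' =>
      hU_emb.tendsto_sobolevENorm hγ' h𝓨_open.measurableSet subset_rfl hlim⟩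
  · have hlim M :
        Tendsto (Phat M) atTop (𝓝 ((kerSpan HP (graphPoints L u M)).starProjection P)) :=
      tendsto_snd_of_tendsto_toL2 <|
        tendsto_toL2_minimizer hU hP hPbar hpde hρ (fun m : Fin M => ha m) (hmin M)
    obtain ⟨G, hlim_G, hG⟩ := exists_tendsto_starProjection_kerSpan (graphPoints_mono L u) P
    have hGB : Set.EqOn G P B := eqOn_of_eqOn_graphPoints hϱ (hP_cont G) (hP_cont P) hG
    refine ⟨fun M => (kerSpan HP (graphPoints L u M)).starProjection P, ⟨fun M s _ =>
      ((RKHS.continuous_eval s).tendsto _).comp (hlim M), fun s hs => ?_⟩, fun η' hη' =>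
      ⟨fun M => hP_emb.tendsto_sobolevENorm hη' .univ (Set.subset_univ B) (hlim M), ?_⟩⟩
    · exact hGB hs ▸ ((RKHS.continuous_eval s).tendsto _).comp hlim_G
    · refine (hP_emb.tendsto_sobolevENorm hη' .univ (Set.subset_univ B) hlim_G).congr fun M => ?_
      exact sobolevENorm_congr_ae <|
        (ae_restrict_eq_of_eqOn (hP_cont G) (hP_cont P) hGB).mono fun s hs => by simp only [hs]

theorem mainTheorem5
    {d Q p : ℕ} {𝓨 : Set (E d)}
    -- the domain
    (h𝓨_open : IsOpen 𝓨) (h𝓨_bdd : Bornology.IsBounded 𝓨) (h𝓨_lip : HasLipschitzBoundary 𝓨)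
    -- the RKHS `HU` of the kernel `𝖴` on `𝓨`, and the RKHS `HP` of the kernel `𝖯` on `ℝ^{d + Q}`
    {HU HP : Type*}
    [NormedAddCommGroup HU] [InnerProductSpace ℝ HU] [CompleteSpace HU] [RKHS ℝ HU 𝓨 ℝ]
    [NormedAddCommGroup HP] [InnerProductSpace ℝ HP] [CompleteSpace HP]
    [RKHS ℝ HP (E (d + Q)) ℝ]
    -- the PDE: differential operators of order at most `p`, known part, boundary condition
    (L : Fin Q → DiffOp 𝓨 p)
    (Pbar : E (d + Q) → ℝ) (hPbar : Continuous Pbar)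
    (bdryOp : (𝓨 → ℝ) → frontier 𝓨 → ℝ) (g : frontier 𝓨 → ℝ)
    -- assumptions on `𝖴`
    (hU_cont : Continuous fun y : 𝓨 × 𝓨 => rkhsKernel HU y.1 y.2)
    (γ : ℕ) (hγ : (d : ℝ) / 2 + p < γ)
    (hU_emb : CompactlyEmbedded (fun v : HU => ext0 (v : 𝓨 → ℝ)) γ 𝓨)
    (hU_bdry : ∀ v : HU, bdryOp v = g)
    -- assumptions on `𝖯`
    (η : ℕ) (hη : ((Q : ℝ) + d) / 2 < η)
    (hP_cont : ∀ G : HP, Continuous (G : E (d + Q) → ℝ))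
    (hP_emb : CompactlyEmbedded (fun G : HP => (G : E (d + Q) → ℝ)) η Set.univ)
    -- the unknown part of the PDE and the training pairs
    (P : HP) (u f : ℕ → 𝓨 → ℝ)
    (hpde : ∀ m y, Pbar (Phi L (u m) y) + P (Phi L (u m) y) = f m y)
    (hbdry : ∀ m, bdryOp (u m) = g)
    -- the observation points and the set `B`
    (Y : ℕ → ℕ → Finset 𝓨) (B : Set (E (d + Q)))
    (hB_open : IsOpen B) (hB_bdd : Bornology.IsBounded B) (hB_lip : HasLipschitzBoundary B)
    -- the fill distances tend to zero
    (hρ : ∀ m, Tendsto (fun N => fillDistance 𝓨 (Subtype.val '' (Y m N : Set 𝓨))) atTop (𝓝 0))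
    (hϱ : Tendsto (fun q : ℕ × ℕ => fillDistance B (dataPoints L u Y q.1 q.2 ∩ B)) atTop (𝓝 0)) :
    -- (a)
    (∀ (M : ℕ) (uhat : ℕ → Fin M → HU) (Phat : ℕ → HP),
      (∀ N, IsMinimizer HU HP L Pbar u f Y M N (uhat N, Phat N)) →
      (∀ m : Fin M, ∃ v : HU, (v : 𝓨 → ℝ) = u m) →
      ∀ m : Fin M,
        (∀ y : 𝓨, Tendsto (fun N => uhat N m y) atTop (𝓝 (u m y))) ∧
        ∀ γ' : ℕ, γ' < γ →
          Tendsto (fun N => sobolevENorm γ' 𝓨 (ext0 fun y => uhat N m y - u m y)) atTop (𝓝 0)) ∧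
    -- (b)
    (∀ (uhat : ∀ M : ℕ, ℕ → Fin M → HU) (Phat : ℕ → ℕ → HP),
      (∀ M N, IsMinimizer HU HP L Pbar u f Y M N (uhat M N, Phat M N)) →
      (∀ m, u m ∈ powerSpace (rkhsKernel HU) 2) →
      ∃ Plim : ℕ → E (d + Q) → ℝ,
        ((∀ M, ∀ s ∈ B, Tendsto (fun N => Phat M N s) atTop (𝓝 (Plim M s))) ∧
          ∀ s ∈ B, Tendsto (fun M => Plim M s) atTop (𝓝 (P s))) ∧
        ∀ η' : ℕ, η' < η →
          (∀ M, Tendsto (fun N => sobolevENorm η' B fun s => Phat M N s - Plim M s)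
            atTop (𝓝 0)) ∧
          Tendsto (fun M => sobolevENorm η' B fun s => Plim M s - P s) atTop (𝓝 0)) := by
  obtain ⟨ha, hb⟩ := mainTheorem5_general h𝓨_open L Pbar hPbar
    (continuous_of_continuous_rkhsKernel hU_cont) γ hγ hU_emb.continuouslyEmbedded η hη hP_cont
    hP_emb.continuouslyEmbedded P u f hpde Y B hρ hϱ
  exact ⟨fun M uhat Phat hmin hu m => (ha M uhat Phat hmin hu m).imp_right fun h γ' hγ' =>
    h γ' hγ'.le, fun uhat Phat hmin hu => (hb uhat Phat hmin fun m =>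
    exists_coe_eq_of_mem_powerSpace one_le_two (hu m)).imp fun _ h => h.imp_right fun h η' hη' =>
    h η' hη'.le⟩
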